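/- Let $k$ be an algebraically closed field of characteristic $0$ and let $G$ be an affine algebraic group over $k$ (not necessarily reductive or connected). For a group $H$ acting linearly on a finite-dimensional $k$-vector space $V$ through a rational representation of an affine algebraic group, let $V_{\rm reg}=\{v\in V : \dim H\cdot v\ge \dim H\cdot w \text{ for all } w\in V\}$; the codimension-2 condition holds for $(H:V)$ if $\operatorname{codim}_V(V\setminus V_{\rm reg})\ge 2$ (the empty set having codimension $+\infty$). A subgroup $S\subset G$ is a generic isotropy group for $(G:V)$ if there is a dense Zariski open subset $\Omega\subset V$ such that the isotropy groups $G_v$, $v\in\Omega$, are all conjugate in $G$ and $S=G_v$ for some $v\in\Omega$. Theorem. Let $V_1,V_2$ be finite-dimensional rational $G$-modules, and let $V=V_1\oplus V_2$ with the diagonal action of $G$. Suppose that generic isotropy groups $S_i$ for $(G:V_i)$, $i=1,2$, exist, and that the codimension-2 condition holds for both $(S_1:V_2)$ and $(S_2:V_1)$ (the actions being the restrictions of those of $G$). Then the codimension-2 condition holds for $(G:V)$. -/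

import Mathlib

/-! Affine algebraic groups over an algebraically closed field `k`, in classical (point) language. -/

/-- The structure of an affine algebraic group over `k` on an abstract group `G`: a finitely
generated algebra `k[G]` of `k`-valued functions on `G` such that the points of `G` are exactly the
`k`-algebra homomorphisms `k[G] → k`, and such that multiplication `G × G → G` and inversion
`G → G` are morphisms, i.e. pull back regular functions to regular functions
(where `k[G × G]` consists of the finite sums `∑ i, a i x * b i y` with `a i`, `b i` in `k[G]`). -/
class AffineAlgebraicGroup (k G : Type*) [Field k] [Group G] where
  coordRing : Subalgebra k (G → k)
  fg : coordRing.FG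
  eval_bijective : Function.Bijective
    (fun g : G => (Pi.evalAlgHom k (fun _ : G => k) g).comp coordRing.val)
  mul_regular : ∀ f ∈ coordRing, ∃ (n : ℕ) (a b : Fin n → coordRing),
    ∀ x y : G, f (x * y) = ∑ i, (a i : G → k) x * (b i : G → k) y
  inv_regular : ∀ f ∈ coordRing, (fun x : G => f x⁻¹) ∈ coordRing

/-- A linear action of `G` on a vector space `V` is rational if all its matrix coefficients
`g ↦ φ (g • v)` are regular functions on `G`. -/
def IsRationalAction (k G V : Type*) [Field k] [Group G] [AffineAlgebraicGroup k G]
    [AddCommGroup V] [Module k V] [DistribMulAction G V] : Prop :=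
  ∀ (φ : Module.Dual k V) (v : V),
    (fun g : G => φ (g • v)) ∈ AffineAlgebraicGroup.coordRing (k := k) (G := G)

section Zariski

/-- The algebra `k[V]` of polynomial functions on `V`: generated by the linear functionals. -/
def regularFunctions (k V : Type*) [Field k] [AddCommGroup V] [Module k V] :
    Subalgebra k (V → k) :=
  Algebra.adjoin k (Set.range fun φ : Module.Dual k V => (φ : V → k))

/-- Zariski open subsets of `V`: complements of the zero loci of sets of polynomial functions. -/
def IsZariskiOpen (k : Type*) {V : Type*} [Field k] [AddCommGroup V] [Module k V]
    (U : Set V) : Prop :=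
  ∃ P : Set (V → k), P ⊆ regularFunctions k V ∧ Uᶜ = {v | ∀ f ∈ P, f v = 0}

/-- Zariski dense subsets of `V`: those that meet every nonempty Zariski open subset. -/
def IsZariskiDense (k : Type*) {V : Type*} [Field k] [AddCommGroup V] [Module k V]
    (X : Set V) : Prop :=
  ∀ U : Set V, IsZariskiOpen k U → U.Nonempty → (X ∩ U).Nonempty

/-- The algebra of restrictions to `X ⊆ V` of the polynomial functions on `V`; it is `k[V] / I(X)`,
the coordinate ring of the Zariski closure of `X`. -/
def restrictedRegularFunctions (k : Type*) {V : Type*} [Field k] [AddCommGroup V] [Module k V]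
    (X : Set V) : Subalgebra k (X → k) :=
  (regularFunctions k V).map
    (AlgHom.pi (fun x : X => Pi.evalAlgHom k (fun _ : V => k) (x : V)))

/-- The dimension of `X ⊆ V`, i.e. the Krull dimension of the coordinate ring `k[V] / I(X)` of its
Zariski closure (`⊥` if `X` is empty). For Zariski locally closed subsets, such as orbits of
algebraic groups, this is the dimension as a variety. -/
noncomputable def zariskiDim (k : Type*) {V : Type*} [Field k] [AddCommGroup V] [Module k V]
    (X : Set V) : WithBot ℕ∞ :=
  ringKrullDim (restrictedRegularFunctions k X)

end Zariski

section Actions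

/-- The set `V_reg` of `H`-regular elements of `V`: those whose orbit has maximal dimension. -/
def regularElements (k H V : Type*) [Field k] [AddCommGroup V] [Module k V]
    [Group H] [MulAction H V] : Set V :=
  {v | ∀ w : V, zariskiDim k (MulAction.orbit H w) ≤ zariskiDim k (MulAction.orbit H v)}

/-- The codimension-`n` condition for `(H : V)`: `codim_V (V \ V_reg) ≥ n`, written as
`dim (V \ V_reg) + n ≤ dim V` (so it holds if `V \ V_reg` is empty). -/
def CodimensionCondition (n : ℕ) (k H V : Type*) [Field k] [AddCommGroup V] [Module k V]
    [Group H] [MulAction H V] : Prop :=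
  zariskiDim k (regularElements k H V)ᶜ + n ≤ (Module.finrank k V : WithBot ℕ∞)

/-- The subgroup `S` of `G` is a generic isotropy group for `(G : V)`: there is a dense Zariski open
subset `Ω` of `V` such that all isotropy groups `G_v`, `v ∈ Ω`, are conjugate in `G`, and `S` is one
of them. -/
def IsGenericIsotropyGroup (k : Type*) {G : Type*} (V : Type*) [Field k] [AddCommGroup V]
    [Module k V] [Group G] [MulAction G V] (S : Subgroup G) : Prop :=
  ∃ Ω : Set V, IsZariskiOpen k Ω ∧ IsZariskiDense k Ω ∧
    (∀ v ∈ Ω, ∀ w ∈ Ω, ∃ g : G,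
      (MulAction.stabilizer G v).map (MulAut.conj g).toMonoidHom = MulAction.stabilizer G w) ∧
    ∃ v ∈ Ω, S = MulAction.stabilizer G v

end Actions

/-! ### Krull dimension and transcendence degree -/

section KrullDimension

/-! Suppose the codimension-2 condition fails for `V₁ × V₂`. The non-regular set is closed and
proper, so it contains the zero set of a nonconstant polynomial function `f`
(`exists_zero_subset_of_not_codim_two`). Such an `f` varies in one of its two variables, by symmetry
the second: `f (x, ·)` is nonconstant for some `x`, hence for all `x` in a nonempty open set. Choose
such an `x` whose stabilizer is conjugate to `S₁` and translate by `G` so that the stabilizer is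
`S₁`. The zero set of the resulting function on `V₂` has codimension one, so it is not contained in
the non-regular set of `(S₁ : V₂)`. This gives a zero of `f` whose translate `(u, y)` has `G_u = S₁`
and `y` regular for `S₁`. Such a pair is `G`-regular, a contradiction
(`exists_zero_finrank_maximal`).

Regularity of the pair rests on `dim G(u, y) = dim Gu + dim G_u y`: both terms take their generic
values at `(u, y)`, and generic orbit dimension is maximal by semicontinuity
(`finrank_le_of_stabilizer_eq`).

Orbit dimensions are computed infinitesimally. In characteristic 0, the dimension of an orbit is the
rank of the derivative of the orbit map on point derivations at `1` (`zariskiDim_orbit`), and the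
kernel of that derivative is the tangent space of the stabilizer (`orbitMap_eq_zero_iff`). The
dimension formula and semicontinuity then become linear algebra. -/

theorem ringKrullDim_le_of_isIntegral {R S : Type*} [CommRing R] [CommRing S] [Algebra R S]
    [Algebra.IsIntegral R S] : ringKrullDim S ≤ ringKrullDim R := by
  refine Order.krullDim_le_of_strictMono (PrimeSpectrum.comap (algebraMap R S)) ?_
  intro p q hpq
  exact Ideal.IsIntegral.comap_lt_comap hpq

/-- Lying over starts a lift of any chain of primes, and going up extends it one prime at a time. -/
theorem ringKrullDim_le_of_isIntegral_of_injective {R S : Type*} [CommRing R] [CommRing S]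
    [Algebra R S] [Algebra.IsIntegral R S] (hinj : Function.Injective (algebraMap R S)) :
    ringKrullDim R ≤ ringKrullDim S := by
  have key : ∀ (n : ℕ) (l : LTSeries (PrimeSpectrum R)), l.length = n →
      ∃ l' : LTSeries (PrimeSpectrum S), l'.length = n ∧
        PrimeSpectrum.comap (algebraMap R S) l'.last = l.last := by
    intro n
    induction n with
    | zero =>
      intro l hl
      obtain ⟨Q, hQ, hQ'⟩ := Ideal.exists_ideal_over_prime_of_isIntegral
        (S := S) l.last.asIdeal ⊥ (by
          intro x hx
          have : algebraMap R S x = 0 := hx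
          rw [(injective_iff_map_eq_zero _).1 hinj x this]
          exact zero_mem _)
      refine ⟨RelSeries.singleton _ ⟨Q, hQ'.1⟩, rfl, ?_⟩
      ext1
      exact hQ'.2
    | succ n ih =>
      intro l hl
      obtain ⟨l', hl', hlast⟩ := ih l.eraseLast (by simp [hl])
      have hlt : l.eraseLast.last < l.last := l.eraseLast_last_rel_last (by omega)
      obtain ⟨Q, hQ, hQ', hQ''⟩ := Ideal.exists_ideal_over_prime_of_isIntegral
        (S := S) l.last.asIdeal l'.last.asIdeal (by
          have := congrArg PrimeSpectrum.asIdeal hlast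
          change Ideal.comap _ _ = _ at this
          rw [this]
          exact hlt.le)
      have hne : l'.last < ⟨Q, hQ'⟩ := by
        refine lt_of_le_of_ne hQ ?_
        rintro h
        rw [h] at hlast
        rw [← hlast] at hlt
        exact absurd (congrArg id hQ'') (fun h => hlt.ne (by ext1; exact h))
      refine ⟨l'.snoc _ hne, by simp [hl'], ?_⟩
      rw [RelSeries.last_snoc]
      ext1
      exact hQ''
  refine iSup_le fun l => ?_
  obtain ⟨l', hl', -⟩ := key _ l rfl
  rw [← hl']
  exact le_iSup (fun p : LTSeries (PrimeSpectrum S) => (p.length : WithBot ℕ∞)) l'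

theorem exists_minimalPrimes_le_ringKrullDim_quotient {A : Type*} [CommRing A] {n : ℕ}
    (h : n ≤ ringKrullDim A) : ∃ Q ∈ minimalPrimes A, n ≤ ringKrullDim (A ⧸ Q) := by
  obtain ⟨l, hl⟩ := Order.le_krullDim_iff.1 h
  obtain ⟨Q, hQ, hQl⟩ := Ideal.exists_minimalPrimes_le (I := ⊥) (J := l.head.asIdeal) bot_le
  refine ⟨Q, hQ, ?_⟩
  rw [ringKrullDim_quotient]
  refine Order.le_krullDim_iff.2 ⟨⟨l.length, fun i => ⟨l i, ?_⟩, fun i => l.step i⟩, hl⟩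
  exact hQl.trans (l.head_le i)

variable {k A : Type*} [Field k] [CommRing A] [IsDomain A] [Algebra k A] [Algebra.FiniteType k A]

theorem exists_isTranscendenceBasis_ringKrullDim_eq : ∃ (s : ℕ) (y : Fin s → A),
    IsTranscendenceBasis k y ∧ ringKrullDim A = s := by
  obtain ⟨s, g, hg, hint⟩ := exists_integral_inj_algHom_of_fg k A
  let _ := g.toRingHom.toAlgebra
  have : Algebra.IsIntegral (MvPolynomial (Fin s) k) A := ⟨hint⟩
  have : IsScalarTower k (MvPolynomial (Fin s) k) A :=
    IsScalarTower.of_algebraMap_eq fun x => (g.commutes x).symm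
  have : FaithfulSMul (MvPolynomial (Fin s) k) A :=
    (faithfulSMul_iff_algebraMap_injective _ _).2 hg
  refine ⟨s, fun i => g (MvPolynomial.X i), ?_, le_antisymm ?_ ?_⟩
  · have hX := IsTranscendenceBasis.mvPolynomial (Fin s) k
    have := hX.algebraMap_comp (A := A)
    exact this
  · refine (ringKrullDim_le_of_isIntegral (R := MvPolynomial (Fin s) k)).trans ?_
    rw [MvPolynomial.ringKrullDim_of_isNoetherianRing]
    simp
  · refine le_trans ?_
      (ringKrullDim_le_of_isIntegral_of_injective (R := MvPolynomial (Fin s) k) hg)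
    rw [MvPolynomial.ringKrullDim_of_isNoetherianRing]
    simp

theorem AlgebraicIndependent.le_ringKrullDim {n : ℕ} {c : Fin n → A}
    (hc : AlgebraicIndependent k c) : n ≤ ringKrullDim A := by
  obtain ⟨s, y, hy, hd⟩ := exists_isTranscendenceBasis_ringKrullDim_eq (k := k) (A := A)
  have h1 := hc.lift_cardinalMk_le_trdeg
  rw [← hy.lift_cardinalMk_eq_trdeg] at h1
  rw [hd]
  simpa using h1

/-- Choosing the independent elements inside a generating set matters later: on an orbit they will
be restrictions of linear functionals, which the derivative of the orbit map can see. -/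
theorem exists_algebraicIndependent_of_le_ringKrullDim {n : ℕ} (h : n ≤ ringKrullDim A)
    {s : Set A} (hs : Algebra.adjoin k s = ⊤) :
    ∃ c : Fin n → A, (∀ i, c i ∈ s) ∧ AlgebraicIndependent k c := by
  obtain ⟨m, y, hy, hd⟩ := exists_isTranscendenceBasis_ringKrullDim_eq (k := k) (A := A)
  have : Algebra.IsAlgebraic (Algebra.adjoin k s) A := by
    refine ⟨fun a => ?_⟩
    have ha : a ∈ Algebra.adjoin k s := hs ▸ Algebra.mem_top
    exact isAlgebraic_algebraMap (⟨a, ha⟩ : Algebra.adjoin k s)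
  obtain ⟨t, hts, ht⟩ := exists_isTranscendenceBasis_subset (R := k) s
  have h1 := ht.lift_cardinalMk_eq_trdeg
  rw [Cardinal.lift_id, Cardinal.lift_id, ← Cardinal.lift_id'.{0} (Algebra.trdeg k A), ← hy.lift_cardinalMk_eq_trdeg] at h1
  have hcard : Cardinal.mk t = m := by simpa using h1
  have : Finite t := by
    rw [← Cardinal.lt_aleph0_iff_finite, hcard]
    exact Cardinal.natCast_lt_aleph0
  have h2 : Nat.card t = m := by rw [Nat.card, hcard]; simp
  have hnm : n ≤ m := by rw [hd] at h; exact_mod_cast h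
  let e : Fin n ↪ t := (Fin.castLEEmb hnm).trans (Finite.equivFinOfCardEq h2).symm.toEmbedding
  exact ⟨fun i => e i, fun i => hts (e i).2, ht.1.comp e e.injective⟩

end KrullDimension

/-! ### Hypersurfaces in affine space -/

section PolynomialFunctions

variable {k ι : Type*} [Field k]

open MvPolynomial

/-- The automorphism of the polynomial ring induced by translation by `a`. -/
noncomputable def MvPolynomial.translate (a : ι → k) : MvPolynomial ι k ≃ₐ[k] MvPolynomial ι k :=
  AlgEquiv.ofAlgHom (aeval fun i => X i + C (a i)) (aeval fun i => X i - C (a i))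
    (by ext; simp [algHom_C]) (by ext; simp [algHom_C])

theorem MvPolynomial.eval_translate (a x : ι → k) (p : MvPolynomial ι k) :
    eval x (translate a p) = eval (x + a) p := by
  change ((aeval x).comp (aeval fun i => X i + C (a i))) p = aeval (x + a) p
  congr 1
  ext
  simp

variable [Finite ι]

/-- Some minimal prime over the vanishing ideal has a quotient of dimension at least `Nat.card ι -
1`. It contains a prime element `f` by unique factorization. A member of the ideal not divisible by
`f` would make the dimension drop twice, once for `f` and once more modulo `f`. -/
theorem MvPolynomial.exists_irreducible_dvd_of_mem_vanishingIdeal [IsAlgClosed k] {S : Set (ι → k)}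
    (hne : vanishingIdeal k S ≠ ⊥)
    (hdim : ¬ ringKrullDim (MvPolynomial ι k ⧸ vanishingIdeal k S) + 2 ≤ (Nat.card ι : ℕ)) :
    ∃ f : MvPolynomial ι k, Irreducible f ∧ ∀ g ∈ vanishingIdeal k S, f ∣ g := by
  have hdimR : ringKrullDim (MvPolynomial ι k) = Nat.card ι := by
    rw [MvPolynomial.ringKrullDim_of_isNoetherianRing]; simp
  set I := vanishingIdeal k S
  obtain ⟨n, hn, hn'⟩ : ∃ n : ℕ, n ≤ ringKrullDim (MvPolynomial ι k ⧸ I) ∧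
      Nat.card ι < n + 2 := by
    have hle := ringKrullDim_quotient_le I
    rw [hdimR] at hle
    rcases hd : ringKrullDim (MvPolynomial ι k ⧸ I) with _ | _ | n
    · rw [hd] at hdim; exact absurd bot_le hdim
    · rw [hd] at hle; exact absurd (WithBot.coe_le_coe.1 hle) (not_le.2 (ENat.natCast_lt_top _))
    · rw [hd] at hdim
      refine ⟨n, le_rfl, ?_⟩
      by_contra! h
      apply hdim
      change ((n : ℕ) : WithBot ℕ∞) + 2 ≤ _
      exact_mod_cast h
  obtain ⟨Q, hQ, hQd⟩ := exists_minimalPrimes_le_ringKrullDim_quotient hn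
  have hQp : Q.IsPrime := hQ.1.1
  set p := Q.comap (Ideal.Quotient.mk I)
  have hp : p.IsPrime := Ideal.comap_isPrime _ _
  have hIp : I ≤ p := by
    intro x hx
    change Ideal.Quotient.mk I x ∈ Q
    rw [Ideal.Quotient.eq_zero_iff_mem.2 hx]
    exact zero_mem _
  have hpd : n ≤ ringKrullDim (MvPolynomial ι k ⧸ p) := by
    refine hQd.trans (ringKrullDim_le_of_surjective
      (Ideal.Quotient.lift p ((Ideal.Quotient.mk Q).comp (Ideal.Quotient.mk I)) ?_) ?_)
    · intro a ha
      exact Ideal.Quotient.eq_zero_iff_mem.2 ha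
    · apply Ideal.Quotient.lift_surjective_of_surjective
      exact Ideal.Quotient.mk_surjective.comp Ideal.Quotient.mk_surjective
  have hpne : p ≠ ⊥ := fun h => hne (le_bot_iff.1 (h ▸ hIp))
  obtain ⟨f, hfp, hf⟩ := hp.exists_mem_prime_of_ne_bot hpne
  refine ⟨f, hf.irreducible, fun g hg => ?_⟩
  by_contra hfg
  have : (Ideal.span {f}).IsPrime := (Ideal.span_singleton_prime hf.ne_zero).2 hf
  have h1 : ringKrullDim (MvPolynomial ι k ⧸ Ideal.span {f}) + 1 ≤ Nat.card ι := by
    rw [← hdimR]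
    exact ringKrullDim_quotient_succ_le_of_nonZeroDivisor (mem_nonZeroDivisors_of_ne_zero hf.ne_zero)
  have hle : Ideal.span {f} ≤ p := (Ideal.span_singleton_le_iff_mem _).2 hfp
  have h2 : ringKrullDim (MvPolynomial ι k ⧸ p) + 1 ≤
      ringKrullDim (MvPolynomial ι k ⧸ Ideal.span {f}) := by
    refine ringKrullDim_succ_le_of_surjective (Ideal.Quotient.factor hle)
      (Ideal.Quotient.factor_surjective hle) (r := Ideal.Quotient.mk _ g) ?_ ?_
    · apply mem_nonZeroDivisors_of_ne_zero
      rw [Ne, Ideal.Quotient.eq_zero_iff_mem, Ideal.mem_span_singleton]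
      exact hfg
    · rw [Ideal.Quotient.factor_mk]
      exact Ideal.Quotient.eq_zero_iff_mem.2 (hIp hg)
  have h3 : (n : WithBot ℕ∞) + 1 + 1 ≤ Nat.card ι :=
    (add_le_add_left ((add_le_add_left hpd 1).trans h2) 1).trans h1
  have h4 : n + 1 + 1 ≤ Nat.card ι := by exact_mod_cast h3
  omega

/-- Some maximal ideal has height equal to the dimension, and translations carry any point to any
other. -/
theorem MvPolynomial.height_vanishingIdeal_singleton [IsAlgClosed k] (x : ι → k) :
    (vanishingIdeal k {x}).height = Nat.card ι := by
  have hdimR : ringKrullDim (MvPolynomial ι k) = Nat.card ι := by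
    rw [MvPolynomial.ringKrullDim_of_isNoetherianRing]; simp
  have : FiniteRingKrullDim (MvPolynomial ι k) := by
    rw [finiteRingKrullDim_iff_ne_bot_and_top, hdimR]
    exact ⟨WithBot.coe_ne_bot (a := ((Nat.card ι : ℕ) : ℕ∞)),
      fun h => ENat.natCast_ne_top _ (WithBot.coe_injective h)⟩
  obtain ⟨m, hm, hmh⟩ := Ideal.exists_isMaximal_height (R := MvPolynomial ι k)
  obtain ⟨y, rfl⟩ := isMaximal_iff_eq_vanishingIdeal_singleton.1 hm
  have h := RingEquiv.height_comap (translate (y - x)).toRingEquiv (vanishingIdeal k {x})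
  have h2 : Ideal.comap (translate (y - x)).toRingEquiv (vanishingIdeal k {x}) =
      vanishingIdeal k {y} := by
    ext p
    rw [Ideal.mem_comap, mem_vanishingIdeal_singleton_iff, mem_vanishingIdeal_singleton_iff]
    have := eval_translate (y - x) x p
    rw [add_sub_cancel] at this
    change aeval x (translate (y - x) p) = 0 ↔ _
    rw [aeval_eq_eval, aeval_eq_eval]
    exact this ▸ Iff.rfl
  rw [← h, h2]
  rw [hdimR] at hmh
  exact_mod_cast hmh

/-- A non-unit `f` vanishes at some point. The maximal ideal there has full height, and dividing by
one element lowers it by at most one. -/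
theorem MvPolynomial.card_le_ringKrullDim_add_one [IsAlgClosed k] {S : Set (ι → k)}
    {f : MvPolynomial ι k} (hf : ¬ IsUnit f) (hS : zeroLocus k (Ideal.span {f}) ⊆ S) :
    (Nat.card ι : ℕ) ≤ ringKrullDim (MvPolynomial ι k ⧸ vanishingIdeal k S) + 1 := by
  obtain ⟨m, hm, hfm⟩ := Ideal.exists_le_maximal (Ideal.span {f})
    (by rwa [Ne, Ideal.span_singleton_eq_top])
  obtain ⟨x, rfl⟩ := isMaximal_iff_eq_vanishingIdeal_singleton.1 hm
  have h1 := Ideal.height_le_ringKrullDim_quotient_add_one (r := f) (p := vanishingIdeal k {x})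
    ((Ideal.span_singleton_le_iff_mem _).1 hfm)
  rw [height_vanishingIdeal_singleton] at h1
  refine le_trans (by exact_mod_cast h1) (add_le_add_left ?_ 1)
  rw [ringKrullDim_quotient, ← PrimeSpectrum.zeroLocus_radical, ← ringKrullDim_quotient]
  have hle : vanishingIdeal k S ≤ (Ideal.span {f}).radical := by
    rw [← vanishingIdeal_zeroLocus_eq_radical (K := k)]
    exact vanishingIdeal_anti_mono hS
  exact ringKrullDim_le_of_surjective (Ideal.Quotient.factor hle)
      (Ideal.Quotient.factor_surjective hle)

end PolynomialFunctions

/-! ### Polynomial functions on a vector space and the codimension-2 condition -/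

section RegularFunctions

variable {k V : Type*} [Field k] [AddCommGroup V] [Module k V]

theorem dual_mem_regularFunctions (φ : Module.Dual k V) :
    (φ : V → k) ∈ regularFunctions k V :=
  Algebra.subset_adjoin ⟨φ, rfl⟩

theorem comp_affine_mem_regularFunctions {W : Type*} [AddCommGroup W] [Module k W]
    (L : W →ₗ[k] V) (c : V) {f : V → k} (hf : f ∈ regularFunctions k V) :
    (fun w => f (L w + c)) ∈ regularFunctions k W := by
  induction hf using Algebra.adjoin_induction with
  | mem x hx =>
    obtain ⟨φ, rfl⟩ := hx
    have : (fun w => φ (L w + c)) = (φ ∘ₗ L : Module.Dual k W) +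
        algebraMap k (W → k) (φ c) := by
      ext w; simp
    simp only [this]
    exact add_mem (dual_mem_regularFunctions _) (Subalgebra.algebraMap_mem _ _)
  | algebraMap r => exact Subalgebra.algebraMap_mem (regularFunctions k W) r
  | add x y _ _ hx hy => exact add_mem hx hy
  | mul x y _ _ hx hy => exact mul_mem hx hy

theorem comp_linear_mem_regularFunctions {W : Type*} [AddCommGroup W] [Module k W]
    (L : W →ₗ[k] V) {f : V → k} (hf : f ∈ regularFunctions k V) :
    (fun w => f (L w)) ∈ regularFunctions k W := by
  simpa using comp_affine_mem_regularFunctions L 0 hf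

theorem isZariskiOpen_preimage_affine {W : Type*} [AddCommGroup W] [Module k W]
    (L : W →ₗ[k] V) (c : V) {U : Set V} (hU : IsZariskiOpen k U) :
    IsZariskiOpen k {w | L w + c ∈ U} := by
  obtain ⟨P, hP, hU⟩ := hU
  refine ⟨(fun f w => f (L w + c)) '' P, ?_, ?_⟩
  · rintro _ ⟨f, hf, rfl⟩
    exact comp_affine_mem_regularFunctions L c (hP hf)
  · ext w
    have : L w + c ∈ Uᶜ ↔ ∀ f ∈ P, f (L w + c) = 0 := by rw [hU]; rfl
    simpa using this

theorem isZariskiOpen_iff_forall_exists {U : Set V} :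
    IsZariskiOpen k U ↔ ∀ v ∈ U, ∃ f ∈ regularFunctions k V, f v ≠ 0 ∧ ∀ w, f w ≠ 0 → w ∈ U := by
  constructor
  · rintro ⟨P, hP, hU⟩ v hv
    have : ¬ v ∈ Uᶜ := fun h => h hv
    rw [hU] at this
    simp only [Set.mem_ofPred_eq, not_forall] at this
    obtain ⟨f, hf, hfv⟩ := this
    refine ⟨f, hP hf, hfv, fun w hw => ?_⟩
    by_contra hwU
    have : w ∈ Uᶜ := hwU
    rw [hU] at this
    exact hw (this f hf)
  · intro h
    refine ⟨{f | f ∈ regularFunctions k V ∧ ∀ w, f w ≠ 0 → w ∈ U}, fun f hf => hf.1, ?_⟩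
    ext v
    constructor
    · intro hv f hf
      by_contra hfv
      exact hv (hf.2 v hfv)
    · intro hv hvU
      obtain ⟨f, hf, hfv, hfU⟩ := h v hvU
      exact hfv (hv f ⟨hf, hfU⟩)

open MvPolynomial

variable (k V) in
/-- The polynomial function on `V` defined by a polynomial in the coordinates of a basis. -/
noncomputable def polynomialFunction [FiniteDimensional k V] :
    MvPolynomial (Fin (Module.finrank k V)) k →ₐ[k] (V → k) :=
  aeval fun i v => (Module.finBasis k V).equivFun v i

variable [FiniteDimensional k V]

theorem polynomialFunction_apply (p : MvPolynomial (Fin (Module.finrank k V)) k) (v : V) :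
    polynomialFunction k V p v = eval ((Module.finBasis k V).equivFun v) p := by
  change ((Pi.evalAlgHom k (fun _ : V => k) v).comp (polynomialFunction k V)) p =
    aeval ((Module.finBasis k V).equivFun v) p
  congr 1
  ext i
  simp [polynomialFunction]

theorem range_polynomialFunction : (polynomialFunction k V).range = regularFunctions k V := by
  rw [polynomialFunction, ← Algebra.adjoin_range_eq_range_aeval]
  apply le_antisymm
  · apply Algebra.adjoin_mono
    rintro _ ⟨i, rfl⟩
    exact ⟨(Module.finBasis k V).coord i, rfl⟩
  · apply Algebra.adjoin_le
    rintro _ ⟨φ, rfl⟩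
    have : (φ : V → k) = ∑ i, φ (Module.finBasis k V i) •
        (fun v => (Module.finBasis k V).equivFun v i : V → k) := by
      ext v
      conv_lhs => rw [← (Module.finBasis k V).sum_equivFun v]
      rw [map_sum]
      simp only [map_smul, Finset.sum_apply, Pi.smul_apply, smul_eq_mul, mul_comm]
    change (φ : V → k) ∈ Algebra.adjoin k _
    rw [this]
    refine sum_mem fun i _ => Subalgebra.smul_mem _ (Algebra.subset_adjoin ?_) _
    exact ⟨i, rfl⟩

theorem zariskiDim_eq_ringKrullDim (X : Set V) :
    zariskiDim k X = ringKrullDim (MvPolynomial (Fin (Module.finrank k V)) k ⧸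
      vanishingIdeal k ((Module.finBasis k V).equivFun '' X)) := by
  set ρ := (AlgHom.pi (fun x : X => Pi.evalAlgHom k (fun _ : V => k) (x : V))).comp
    (polynomialFunction k V)
  have hr : restrictedRegularFunctions k X = ρ.range := by
    rw [restrictedRegularFunctions, ← range_polynomialFunction, AlgHom.range_comp]
  have hker : RingHom.ker ρ.rangeRestrict =
      vanishingIdeal k ((Module.finBasis k V).equivFun '' X) := by
    ext p
    rw [RingHom.mem_ker, mem_vanishingIdeal_iff]
    constructor
    · rintro h _ ⟨v, hv, rfl⟩
      have := congrFun (congrArg Subtype.val h) ⟨v, hv⟩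
      change polynomialFunction k V p v = 0 at this
      rwa [polynomialFunction_apply] at this
    · intro h
      ext ⟨v, hv⟩
      change polynomialFunction k V p v = 0
      rw [polynomialFunction_apply]
      exact h _ ⟨v, hv, rfl⟩
  rw [zariskiDim, hr, ← hker]
  exact (ringKrullDim_eq_of_ringEquiv (Ideal.quotientKerAlgEquivOfSurjective
    ρ.rangeRestrict_surjective).toRingEquiv).symm

variable [IsAlgClosed k]

theorem exists_zero_subset_of_not_codim_two {Z : Set V} (hZ : IsZariskiOpen k Zᶜ)
    (hne : Zᶜ.Nonempty)
    (hdim : ¬ zariskiDim k Z + 2 ≤ (Module.finrank k V : WithBot ℕ∞)) :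
    ∃ f ∈ regularFunctions k V, (∃ v w, f v ≠ f w) ∧ ∀ v, f v = 0 → v ∈ Z := by
  set E := (Module.finBasis k V).equivFun
  rw [zariskiDim_eq_ringKrullDim] at hdim
  have hclosed : ∀ v, v ∉ Z → ∃ p ∈ vanishingIdeal k (E '' Z), eval (E v) p ≠ 0 := by
    intro v hv
    obtain ⟨f, hf, hfv, hfZ⟩ := isZariskiOpen_iff_forall_exists.1 hZ v hv
    rw [← range_polynomialFunction] at hf
    obtain ⟨p, rfl⟩ := hf
    refine ⟨p, ?_, by rwa [← polynomialFunction_apply]⟩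
    rintro _ ⟨w, hw, rfl⟩
    by_contra h
    refine hfZ w ?_ hw
    change polynomialFunction k V p w ≠ 0
    rwa [polynomialFunction_apply]
  obtain ⟨f, hf, hfd⟩ := exists_irreducible_dvd_of_mem_vanishingIdeal (k := k)
    (S := E '' Z) (by
      obtain ⟨v, hv⟩ := hne
      obtain ⟨p, hp, hpv⟩ := hclosed v hv
      intro h
      rw [h] at hp
      rw [(Submodule.mem_bot _).1 hp] at hpv
      simp at hpv) (by simpa using hdim)
  refine ⟨polynomialFunction k V f, ?_, ?_, ?_⟩
  · rw [← range_polynomialFunction]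
    exact ⟨f, rfl⟩
  · by_contra! h
    have h0 : f = C (eval 0 f) := by
      apply MvPolynomial.funext
      intro x
      have := h (E.symm x) 0
      rw [polynomialFunction_apply, polynomialFunction_apply] at this
      rw [eval_C]
      change eval (E (E.symm x)) f = eval (E 0) f at this
      rwa [E.apply_symm_apply, map_zero] at this
    by_cases hz : eval 0 f = 0
    · exact hf.ne_zero (by rw [h0, hz, C_0])
    · exact hf.not_isUnit (by rw [h0]; exact (isUnit_iff_ne_zero.2 hz).map C)
  · intro v hv
    by_contra hvZ
    obtain ⟨p, hp, hpv⟩ := hclosed v hvZ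
    obtain ⟨q, rfl⟩ := hfd p hp
    rw [polynomialFunction_apply] at hv
    apply hpv
    rw [eval_mul, hv, zero_mul]

/-- Over an algebraically closed field a nonconstant polynomial has a nonempty zero set of
codimension one. -/
theorem not_codim_two_of_zero_subset {Y : Set V} {f : V → k} (hf : f ∈ regularFunctions k V)
    (hne : ∃ v w, f v ≠ f w) (hY : ∀ v, f v = 0 → v ∈ Y) :
    ¬ zariskiDim k Y + 2 ≤ (Module.finrank k V : WithBot ℕ∞) := by
  rw [← range_polynomialFunction] at hf
  obtain ⟨p, rfl⟩ := hf
  intro h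
  rw [zariskiDim_eq_ringKrullDim] at h
  have h1 := card_le_ringKrullDim_add_one (f := p)
    (S := (Module.finBasis k V).equivFun '' Y) ?_ ?_
  · simp only [Nat.card_eq_fintype_card, Fintype.card_fin] at h1
    rcases hd : ringKrullDim (MvPolynomial (Fin (Module.finrank k V)) k ⧸
      vanishingIdeal k ((Module.finBasis k V).equivFun '' Y)) with _ | _ | n
    · rw [hd] at h1
      exact absurd (le_bot_iff.1 h1) (WithBot.coe_ne_bot (a := ((Module.finrank k V : ℕ) : ℕ∞)))
    · rw [hd] at h
      exact absurd (WithBot.coe_le_coe.1 (show ((⊤ : ℕ∞) : WithBot ℕ∞) ≤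
        ((Module.finrank k V : ℕ∞) : WithBot ℕ∞) from h)) (not_le.2 (ENat.natCast_lt_top _))
    · rw [hd] at h h1
      have h : ((n : ℕ) : WithBot ℕ∞) + 2 ≤ (Module.finrank k V : WithBot ℕ∞) := h
      have h1 : (Module.finrank k V : WithBot ℕ∞) ≤ ((n : ℕ) : WithBot ℕ∞) + 1 := h1
      have h2 : n + 2 ≤ Module.finrank k V := by exact_mod_cast h
      have h3 : Module.finrank k V ≤ n + 1 := by exact_mod_cast h1
      omega
  · rw [isUnit_iff_eq_C_of_isReduced]
    rintro ⟨r, -, rfl⟩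
    obtain ⟨v, w, hvw⟩ := hne
    apply hvw
    change polynomialFunction k V _ v = polynomialFunction k V _ w
    simp [polynomialFunction_apply]
  · intro x hx
    refine ⟨(Module.finBasis k V).equivFun.symm x, hY _ ?_,
      LinearEquiv.apply_symm_apply _ x⟩
    change polynomialFunction k V p _ = 0
    rw [polynomialFunction_apply, LinearEquiv.apply_symm_apply]
    simpa using hx p (Ideal.mem_span_singleton_self p)

end RegularFunctions

/-! ### Minimal primes of reduced Noetherian rings -/

section MinimalPrimes

variable {B : Type*} [CommRing B] [IsReduced B]

/-- Geometrically, `s` vanishes on every irreducible component except that of `P`. Then `s * p` lies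
in all minimal primes, whose intersection is zero in a reduced ring. -/
theorem exists_notMem_mul_eq_zero_of_mem_minimalPrimes [IsNoetherianRing B] {P : Ideal B}
    (hP : P ∈ minimalPrimes B) : ∃ s, s ∉ P ∧ ∀ p ∈ P, s * p = 0 := by
  classical
  have hPp : P.IsPrime := hP.1.1
  have hfin := minimalPrimes.finite_of_isNoetherianRing B
  have hQ : ∀ Q : Ideal B, ∃ s : B, s ∉ P ∧ (Q ∈ minimalPrimes B → Q ≠ P → s ∈ Q) := by
    intro Q
    by_cases h : Q ∈ minimalPrimes B ∧ Q ≠ P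
    · have : ¬ Q ≤ P := fun hle => h.2 (le_antisymm hle (hP.2 h.1.1 hle))
      obtain ⟨s, hsQ, hsP⟩ := Set.not_subset.1 this
      exact ⟨s, hsP, fun _ _ => hsQ⟩
    · exact ⟨1, fun h1 => hPp.ne_top ((Ideal.eq_top_iff_one _).2 h1),
        fun h1 h2 => absurd ⟨h1, h2⟩ h⟩
  choose s hsP hsQ using hQ
  refine ⟨∏ Q ∈ hfin.toFinset, s Q, ?_, ?_⟩
  · rw [hPp.prod_mem_iff]
    rintro ⟨Q, -, h⟩
    exact hsP Q h
  · intro p hp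
    have hmem : (∏ Q ∈ hfin.toFinset, s Q) * p ∈ sInf (⊥ : Ideal B).minimalPrimes := by
      rw [Ideal.mem_sInf]
      intro Q hQ
      by_cases h : Q = P
      · exact h ▸ Ideal.mul_mem_left _ _ hp
      · refine Ideal.mul_mem_right _ _ (Ideal.mem_of_dvd _
          (Finset.dvd_prod_of_mem s (hfin.mem_toFinset.2 hQ)) (hsQ Q hQ h))
    rw [Ideal.sInf_minimalPrimes] at hmem
    obtain ⟨n, hn⟩ := hmem
    exact IsReduced.eq_zero _ ⟨n, (Submodule.mem_bot _).1 hn⟩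

/-- Apply the Leibniz rule to `s * a = 0` with the annihilator `s ∉ P`. -/
theorem Derivation.mem_of_mem_minimalPrimes {k : Type*} [CommRing k] [Algebra k B]
    [IsNoetherianRing B] (D : Derivation k B B) {P : Ideal B} (hP : P ∈ minimalPrimes B) {a : B}
    (ha : a ∈ P) : D a ∈ P := by
  obtain ⟨s, hs, hsP⟩ := exists_notMem_mul_eq_zero_of_mem_minimalPrimes hP
  have hPp : P.IsPrime := hP.1.1
  have h1 : s * D a + a * D s = 0 := by
    have := D.leibniz s a
    rw [hsP a ha, map_zero, smul_eq_mul, smul_eq_mul] at this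
    exact this.symm
  have h2 : s * D a ∈ P := by
    rw [eq_neg_of_add_eq_zero_left h1]
    exact neg_mem (Ideal.mul_mem_right _ _ ha)
  exact (hPp.mem_or_mem h2).resolve_left hs

end MinimalPrimes

/-! ### Derivations in characteristic 0 -/

section Derivations

variable {k B : Type*} [Field k] [CharZero k] [CommRing B] [Algebra k B]

theorem Derivation.mem_radical_of_mem_radical (D : Derivation k B B) {J : Ideal B}
    (hJ : ∀ a ∈ J, D a ∈ J) {a : B} (ha : a ∈ J.radical) : D a ∈ J.radical := by
  obtain ⟨n, hn⟩ := ha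
  -- Each step trades one factor `a` for two factors `D a`: the first comes from differentiating,
  -- the second allows the term with `D (D a)` to be subtracted as a multiple of the previous
  -- element. The coefficient left over is a positive integer, invertible in characteristic 0.
  have key : ∀ i ≤ n, a ^ (n - i) * D a ^ (2 * i) ∈ J := by
    intro i
    induction i with
    | zero => intro _; simpa using hn
    | succ i ih =>
      intro hi
      obtain ⟨m, hm⟩ : ∃ m, n - i = m + 1 := ⟨n - i - 1, by omega⟩
      have h := ih (by omega)
      have hm' : n - (i + 1) = m := by omega
      rw [hm] at h
      rw [hm']
      have h1 := hJ _ h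
      rw [D.leibniz, D.leibniz_pow, D.leibniz_pow] at h1
      simp only [smul_eq_mul, nsmul_eq_mul, Nat.add_sub_cancel] at h1
      have h2 := J.mul_mem_left (D a) h1
      have h3 := J.mul_mem_left ((2 * i : ℕ) * D (D a)) h
      have h4 : ((m + 1 : ℕ) : B) * (a ^ m * D a ^ (2 * (i + 1))) ∈ J := by
        have := sub_mem h2 h3
        convert this using 1
        -- The exponent `2 * i - 1` is truncated at `i = 0`, where its coefficient vanishes anyway.
        rcases i with _ | i
        · simp; ring
        · rw [show 2 * (i + 1) - 1 = 2 * i + 1 by omega]; ring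
      have h5 := J.mul_mem_left (algebraMap k B ((m + 1 : ℕ) : k)⁻¹) h4
      rwa [← mul_assoc, ← _root_.map_natCast (algebraMap k B), ← map_mul,
        inv_mul_cancel₀ (Nat.cast_ne_zero.2 (by omega)), map_one, one_mul] at h5
  have := key n le_rfl
  rw [Nat.sub_self, pow_zero, one_mul] at this
  exact ⟨_, this⟩

omit [CharZero k] in
theorem Derivation.map_mvPolynomial_aeval {M σ : Type*} [Fintype σ] [AddCommGroup M] [Module B M]
    [Module k M] [IsScalarTower k B M] (D : Derivation k B M) (c : σ → B) (p : MvPolynomial σ k) :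
    D (MvPolynomial.aeval c p) =
      ∑ i, MvPolynomial.aeval c (MvPolynomial.pderiv i p) • D (c i) := by
  classical
  induction p using MvPolynomial.induction_on with
  | C r => simp
  | add p q hp hq => simp [hp, hq, add_smul, Finset.sum_add_distrib]
  | mul_X p j hp =>
    simp only [map_mul, MvPolynomial.aeval_X, D.leibniz, hp, Derivation.leibniz, smul_eq_mul,
      map_add, add_smul, Finset.sum_add_distrib, MvPolynomial.pderiv_X, Finset.smul_sum, mul_smul]
    congr 1
    rw [Finset.sum_eq_single j]
    · simp
    · intro i _ hij
      simp [hij.symm]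
    · simp

theorem MvPolynomial.exists_pderiv_ne_zero {σ : Type*} {p : MvPolynomial σ k}
    (hp : p.totalDegree ≠ 0) : ∃ i, pderiv i p ≠ 0 ∧
      (pderiv i p).totalDegree < p.totalDegree := by
  classical
  obtain ⟨m, hm, hmd⟩ : ∃ m ∈ p.support, m ≠ 0 := by
    by_contra! h
    apply hp
    rw [totalDegree_eq_zero_iff]
    intro m hm
    simp [h m hm]
  obtain ⟨i, hi⟩ := Finsupp.ne_iff.1 hmd
  have hi : m i ≠ 0 := hi
  refine ⟨i, ?_, ?_⟩
  · intro h
    have := congrArg (coeff (m - Finsupp.single i 1)) h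
    rw [coeff_pderiv, coeff_zero] at this
    have he : m - Finsupp.single i 1 + Finsupp.single i 1 = m :=
      tsub_add_cancel_of_le (by rw [Finsupp.single_le_iff]; omega)
    rw [he] at this
    rcases mul_eq_zero.1 this with h | h
    · exact mem_support_iff.1 hm h
    · exact absurd (by exact_mod_cast h) (Nat.succ_ne_zero ((m - Finsupp.single i 1 : σ →₀ ℕ) i))
  · rw [totalDegree, Finset.sup_lt_iff (Nat.pos_of_ne_zero hp)]
    intro d hd
    rw [mem_support_iff, coeff_pderiv] at hd
    have := le_totalDegree (mem_support_iff.2 (left_ne_zero_of_mul hd))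
    refine lt_of_lt_of_le ?_ this
    change d.degree < (d + Finsupp.single i 1).degree
    simp

/-- The Jacobian criterion for algebraic independence modulo a differential prime ideal. -/
theorem algebraicIndependent_of_det_notMem {n : ℕ} {P : Ideal B} [P.IsPrime]
    (D : Fin n → Derivation k B B) (hD : ∀ j, ∀ a ∈ P, D j a ∈ P) (c : Fin n → B)
    (hdet : (Matrix.of fun j i => D j (c i)).det ∉ P) :
    AlgebraicIndependent k (fun i => Ideal.Quotient.mk P (c i)) := by
  have hmk : ∀ p : MvPolynomial (Fin n) k,
      MvPolynomial.aeval (fun i => Ideal.Quotient.mk P (c i)) p =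
        Ideal.Quotient.mk P (MvPolynomial.aeval c p) := fun p =>
    (DFunLike.congr_fun (MvPolynomial.comp_aeval (f := c) (Ideal.Quotient.mkₐ k P)) p).symm
  -- Induction on the degree of a relation modulo `P`. Applying every `D j` shows that the Jacobian
  -- matrix kills the gradient of `p`, so each partial derivative of `p` is again a relation. In
  -- characteristic 0 some partial derivative is nonzero of smaller degree.
  have key : ∀ (N : ℕ) (p : MvPolynomial (Fin n) k), p.totalDegree = N →
      MvPolynomial.aeval c p ∈ P → p = 0 := by
    intro N
    induction N using Nat.strong_induction_on with
    | _ N ih =>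
      intro p hpN hp
      by_contra hp0
      by_cases hN : p.totalDegree = 0
      · rw [MvPolynomial.totalDegree_eq_zero_iff_eq_C] at hN
        rw [hN, MvPolynomial.aeval_C] at hp
        have hu : IsUnit (algebraMap k B (p.coeff 0)) := by
          apply IsUnit.map
          rw [isUnit_iff_ne_zero]
          intro h0
          rw [h0, map_zero] at hN
          exact hp0 hN
        exact Ideal.IsPrime.ne_top ‹_› (Ideal.eq_top_of_isUnit_mem _ hp hu)
      · obtain ⟨i, hi, hilt⟩ := MvPolynomial.exists_pderiv_ne_zero hN
        refine hi (ih _ (hpN ▸ hilt) _ rfl ?_)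
        set x : Fin n → B ⧸ P := fun i =>
          Ideal.Quotient.mk P (MvPolynomial.aeval c (MvPolynomial.pderiv i p))
        set M : Matrix (Fin n) (Fin n) (B ⧸ P) :=
          (Ideal.Quotient.mk P).mapMatrix (Matrix.of fun j i => D j (c i))
        have hMx : M.mulVec x = 0 := by
          ext j
          have h1 := hD j _ hp
          rw [Derivation.map_mvPolynomial_aeval] at h1
          have h2 := Ideal.Quotient.eq_zero_iff_mem.2 h1
          simp only [map_sum, smul_eq_mul, map_mul] at h2
          simpa [Matrix.mulVec, dotProduct, M, x, mul_comm] using h2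
        have hdetM : M.det ≠ 0 := by
          rw [← RingHom.map_det]
          rwa [Ne, Ideal.Quotient.eq_zero_iff_mem]
        have := Matrix.eq_zero_of_mulVec_eq_zero hdetM hMx
        exact Ideal.Quotient.eq_zero_iff_mem.1 (congrFun this i)
  rw [algebraicIndependent_iff]
  intro p hp
  rw [hmk, Ideal.Quotient.eq_zero_iff_mem] at hp
  exact key _ p rfl hp

omit [CharZero k] in
-- For a formally étale extension, the differentials of `T` are those of `S` after base change, so a
-- derivation is determined by its values on `S` and these may be prescribed.
theorem Derivation.exists_extension_of_formallyEtale {S T : Type*} [CommRing S] [CommRing T]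
    [Algebra k S] [Algebra k T] [Algebra S T] [IsScalarTower k S T] [Algebra.FormallyEtale S T]
    (d : Derivation k S T) : ∃ D : Derivation k T T, ∀ s, D (algebraMap S T s) = d s := by
  let e := KaehlerDifferential.tensorKaehlerEquivOfFormallyEtale k S T
  let l : TensorProduct S T (Ω[S⁄k]) →ₗ[T] T :=
    TensorProduct.AlgebraTensorModule.lift
      ((LinearMap.toSpanSingleton T (Ω[S⁄k] →ₗ[S] T) d.liftKaehlerDifferential))
  refine ⟨(l ∘ₗ e.symm.toLinearMap).compDer (KaehlerDifferential.D k T), fun s => ?_⟩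
  change l (e.symm (KaehlerDifferential.D k T (algebraMap S T s))) = _
  rw [KaehlerDifferential.tensorKaehlerEquivOfFormallyEtale_symm_D_algebraMap]
  simp [l]

/-- Complete `c` to a transcendence basis. In characteristic 0, `K` is separable algebraic over the
rational function field, hence formally étale over the polynomial ring, and partial derivatives
extend. -/
theorem AlgebraicIndependent.exists_dual_derivations {K : Type*} [Field K] [Algebra k K] {n : ℕ}
    {c : Fin n → K} (hc : AlgebraicIndependent k c) :
    ∃ D : Fin n → Derivation k K K, ∀ i j, D i (c j) = if i = j then 1 else 0 := by
  classical
  obtain ⟨t, hct, ht⟩ := exists_isTranscendenceBasis_superset hc.to_subtype_range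
  let S := MvPolynomial t k
  let _ : Algebra S K := (MvPolynomial.aeval (Subtype.val : t → K)).toRingHom.toAlgebra
  have : IsScalarTower k S K := IsScalarTower.of_algebraMap_eq fun x =>
    ((MvPolynomial.aeval (Subtype.val : t → K)).commutes x).symm
  have hinj : Function.Injective (algebraMap S K) := ht.1
  have : FaithfulSMul S K := (faithfulSMul_iff_algebraMap_injective _ _).2 hinj
  let F := FractionRing S
  let _ : Algebra F K := FractionRing.liftAlgebra S K
  have : IsScalarTower S F K := FractionRing.isScalarTower_liftAlgebra S K
  have : Algebra.IsAlgebraic S K := by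
    have h1 := ht.isAlgebraic
    refine Algebra.IsAlgebraic.of_ringHom_of_comp_eq (f := ht.1.aevalEquiv) (g := RingHom.id K)
      ht.1.aevalEquiv.surjective Function.injective_id ?_
    refine RingHom.ext fun p => ?_
    exact ht.1.algebraMap_aevalEquiv p
  have : Algebra.IsAlgebraic F K := Algebra.IsAlgebraic.extendScalars (R := S)
    (IsFractionRing.injective S F)
  have : CharZero F := charZero_of_injective_algebraMap (algebraMap k F).injective
  have : Algebra.FormallyEtale F K := Algebra.FormallyEtale.of_isSeparable F K
  have : Algebra.FormallyEtale S F := Algebra.FormallyEtale.of_isLocalization (nonZeroDivisors S)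
  have : Algebra.FormallyEtale S K := Algebra.FormallyEtale.comp S F K
  have hD : ∀ i, ∃ D : Derivation k K K, ∀ j, D (c j) = if i = j then 1 else 0 := by
    intro i
    obtain ⟨D, hD⟩ := Derivation.exists_extension_of_formallyEtale
      (MvPolynomial.mkDerivation k (A := K) (fun x : t => if c i = x then 1 else 0))
    refine ⟨D, fun j => ?_⟩
    have := hD (MvPolynomial.X ⟨c j, hct ⟨j, rfl⟩⟩)
    rw [MvPolynomial.mkDerivation_X] at this
    have hX : algebraMap S K (MvPolynomial.X ⟨c j, hct ⟨j, rfl⟩⟩) = c j :=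
      MvPolynomial.aeval_X _ _
    rw [hX] at this
    rw [this]
    simp only [hc.injective.eq_iff]
  choose D hD using hD
  exact ⟨D, hD⟩

end Derivations

/-! ### Specializing derivations to points -/

section PointDerivations

variable {k : Type*} [Field k] [CharZero k]

/-- The element `d` is a common denominator for the dual derivations of the fraction field on a
finite set of generators of `A`; the Leibniz rule propagates integrality from there. -/
theorem AlgebraicIndependent.exists_dual_derivations_of_finiteType {A C : Type*}
    [CommRing A] [Algebra k A] [Algebra.FiniteType k A] [CommRing C] [IsDomain C] [Algebra k C]
    (π : A →ₐ[k] C) {n : ℕ} {c : Fin n → A} (hc : AlgebraicIndependent k (fun i => π (c i))) :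
    ∃ (d : C) (e : Fin n → A →ₗ[k] C), d ≠ 0 ∧
      (∀ i f g, e i (f * g) = π f * e i g + π g * e i f) ∧
      ∀ i j, e i (c j) = if i = j then d else 0 := by
  classical
  let K := FractionRing C
  let j : C →ₐ[k] K := IsScalarTower.toAlgHom k C K
  have hj : Function.Injective j := IsFractionRing.injective C K
  obtain ⟨D, hD⟩ := ((AlgHom.algebraicIndependent_iff j hj).2 hc).exists_dual_derivations
  obtain ⟨s, hs⟩ := ‹Algebra.FiniteType k A›.out
  obtain ⟨⟨d, hd⟩, hdi⟩ := IsLocalization.exist_integer_multiples_of_finset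
    (nonZeroDivisors C) (S := K)
    ((Finset.univ ×ˢ s).image fun p : Fin n × A => D p.1 (j (π p.2)))
  have hint : ∀ (i : Fin n) (f : A), ∃ q : C, j q = j d * D i (j (π f)) := by
    intro i f
    have hf : f ∈ Algebra.adjoin k (s : Set A) := hs ▸ Algebra.mem_top
    induction hf using Algebra.adjoin_induction with
    | mem x hx =>
      have hx' : (i, x) ∈ Finset.univ ×ˢ s := Finset.mem_product.2 ⟨Finset.mem_univ i, hx⟩
      obtain ⟨q, hq⟩ := hdi _ (Finset.mem_image_of_mem _ hx')
      refine ⟨q, hq.trans ?_⟩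
      change (d • _ : K) = _
      rw [Algebra.smul_def]
      rfl
    | algebraMap r => exact ⟨0, by simp⟩
    | add x y _ _ hx hy =>
      obtain ⟨a, ha⟩ := hx
      obtain ⟨b, hb⟩ := hy
      exact ⟨a + b, by simp only [map_add, ha, hb, mul_add]⟩
    | mul x y _ _ hx hy =>
      obtain ⟨a, ha⟩ := hx
      obtain ⟨b, hb⟩ := hy
      refine ⟨π x * b + π y * a, ?_⟩
      simp only [map_add, map_mul, ha, hb, Derivation.leibniz, smul_eq_mul]
      ring
  choose e he using hint
  refine ⟨d, fun i =>
    { toFun := e i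
      map_add' := fun f g => ?_
      map_smul' := fun r f => ?_ }, nonZeroDivisors.ne_zero hd, fun i f g => ?_, fun i l => ?_⟩
  · apply hj
    simp only [map_add, he, mul_add]
  · apply hj
    simp only [map_smul, he, Derivation.map_smul, mul_smul_comm, RingHom.id_apply]
  · apply hj
    change j (e i (f * g)) = j (π f * e i g + π g * e i f)
    simp only [map_mul, map_add, he, Derivation.leibniz, smul_eq_mul]
    ring
  · apply hj
    change j (e i (c l)) = _
    rw [he]
    have := hD i l
    change D i (j (π (c l))) = _ at this
    rw [this]
    split_ifs
    · rw [mul_one]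
    · rw [mul_zero, map_zero]

/-- Evaluate at a point where neither the denominator `d'` nor the annihilator `t` of `P` vanishes.
Since `t` is nonzero there, evaluation kills `P` and factors through `A ⧸ P`. -/
theorem exists_dual_point_derivations {A X : Type*} [CommRing A] [IsReduced A] [Algebra k A]
    [Algebra.FiniteType k A] {ev : X → A →ₐ[k] k} (hsep : ∀ f, (∀ x, ev x f = 0) → f = 0)
    {P : Ideal A} (hP : P ∈ minimalPrimes A) {n : ℕ} {c : Fin n → A}
    (hc : AlgebraicIndependent k (fun i => Ideal.Quotient.mk P (c i))) :
    ∃ (x : X) (δ : Fin n → (A →ₗ[k] k)),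
      (∀ i f g, δ i (f * g) = ev x f * δ i g + ev x g * δ i f) ∧
      ∀ i j, δ i (c j) = if i = j then 1 else 0 := by
  have hPp : P.IsPrime := hP.1.1
  have := Algebra.FiniteType.isNoetherianRing k A
  obtain ⟨d, e, hd, hmul, hec⟩ := AlgebraicIndependent.exists_dual_derivations_of_finiteType
    (Ideal.Quotient.mkₐ k P) hc
  obtain ⟨t, ht, htP⟩ := exists_notMem_mul_eq_zero_of_mem_minimalPrimes hP
  obtain ⟨d', rfl⟩ := Ideal.Quotient.mk_surjective d
  have hd' : d' ∉ P := fun h => hd (Ideal.Quotient.eq_zero_iff_mem.2 h)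
  have htd : t * d' ≠ 0 := fun h => by
    have : t * d' ∈ P := h ▸ zero_mem P
    exact (hPp.mem_or_mem this).elim ht hd'
  obtain ⟨x, hx⟩ : ∃ x, ev x (t * d') ≠ 0 := by
    by_contra! h
    exact htd (hsep _ h)
  rw [map_mul] at hx
  have hev : ∀ p ∈ P, ev x p = 0 := by
    intro p hp
    have := congrArg (ev x) (htP p hp)
    rw [map_mul, map_zero] at this
    exact (mul_eq_zero.1 this).resolve_left (left_ne_zero_of_mul hx)
  let ε : (A ⧸ P) →ₐ[k] k := Ideal.Quotient.liftₐ P (ev x) hev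
  have hε : ∀ f : A, ε (Ideal.Quotient.mkₐ k P f) = ev x f := fun f => rfl
  refine ⟨x, fun i => (ev x d')⁻¹ • (ε.toLinearMap ∘ₗ e i), fun i f g => ?_, fun i l => ?_⟩
  · simp only [LinearMap.smul_apply, LinearMap.comp_apply, AlgHom.toLinearMap_apply, smul_eq_mul]
    rw [hmul, map_add, map_mul, map_mul, hε, hε]
    ring
  · simp only [LinearMap.smul_apply, LinearMap.comp_apply, AlgHom.toLinearMap_apply, smul_eq_mul]
    rw [hec]
    split_ifs
    · exact inv_mul_cancel₀ (right_ne_zero_of_mul hx)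
    · rw [map_zero, mul_zero]

variable {A B : Type*} [CommRing A] [Algebra k A] [Algebra.FiniteType k A]
  [CommRing B] [IsReduced B] [Algebra k B] [Algebra.FiniteType k B]

/-- Choose a minimal prime of `B` inside the kernel of `ev`. Derivations preserve it and it omits
the determinant, so the Jacobian criterion applies modulo it. -/
theorem le_ringKrullDim_of_det_ne_zero (ι : A →ₐ[k] B) (ev : B →ₐ[k] k) {n : ℕ}
    (D : Fin n → Derivation k B B) (c : Fin n → A)
    (hdet : (Matrix.of fun j i => ev (D j (ι (c i)))).det ≠ 0) : n ≤ ringKrullDim A := by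
  have := Algebra.FiniteType.isNoetherianRing k B
  have hker : (RingHom.ker ev).IsPrime := RingHom.ker_isPrime _
  obtain ⟨P, hP, hPle⟩ := Ideal.exists_minimalPrimes_le (I := ⊥) (J := RingHom.ker ev) bot_le
  have hPp : P.IsPrime := hP.1.1
  have hc : AlgebraicIndependent k (fun i => Ideal.Quotient.mk P (ι (c i))) := by
    refine algebraicIndependent_of_det_notMem D
      (fun j a ha => Derivation.mem_of_mem_minimalPrimes _ hP ha) _ fun hmem => hdet ?_
    have h0 : ev _ = 0 := hPle hmem
    rw [AlgHom.map_det] at h0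
    exact h0
  let ψ : A →ₐ[k] B ⧸ P := (Ideal.Quotient.mkₐ k P).comp ι
  have : Algebra.FiniteType k ψ.range :=
    Algebra.FiniteType.of_surjective ψ.rangeRestrict ψ.rangeRestrict_surjective
  have hc' : AlgebraicIndependent k (fun i => ψ.rangeRestrict (c i)) :=
    (AlgHom.algebraicIndependent_iff ψ.range.val Subtype.val_injective).1 hc
  exact hc'.le_ringKrullDim.trans
    (ringKrullDim_le_of_surjective ψ.rangeRestrict.toRingHom ψ.rangeRestrict_surjective)

/-- As `ι` is injective, a minimal prime `Q` of large dimension lies under a minimal prime of `B`,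
so independence modulo `Q` survives in `B`. -/
theorem exists_dual_point_derivations_of_le_ringKrullDim {X : Type*} {ev : X → B →ₐ[k] k}
    (hsep : ∀ f, (∀ x, ev x f = 0) → f = 0) {ι : A →ₐ[k] B} (hι : Function.Injective ι)
    {s : Set A} (hs : Algebra.adjoin k s = ⊤) {n : ℕ} (hn : n ≤ ringKrullDim A) :
    ∃ (a : Fin n → A) (x : X) (δ : Fin n → (B →ₗ[k] k)), (∀ i, a i ∈ s) ∧
      (∀ i f g, δ i (f * g) = ev x f * δ i g + ev x g * δ i f) ∧
      ∀ i j, δ i (ι (a j)) = if i = j then 1 else 0 := by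
  obtain ⟨Q, hQ, hnQ⟩ := exists_minimalPrimes_le_ringKrullDim_quotient hn
  have hQp : Q.IsPrime := hQ.1.1
  have hadj := congrArg (Subalgebra.map (Ideal.Quotient.mkₐ k Q)) hs
  rw [AlgHom.map_adjoin, Algebra.map_top, (AlgHom.range_eq_top _).2
    (Ideal.Quotient.mkₐ_surjective k Q)] at hadj
  obtain ⟨c, hcs, hc⟩ := exists_algebraicIndependent_of_le_ringKrullDim hnQ hadj
  choose a has hac using hcs
  obtain ⟨P, hP, hPQ⟩ := Ideal.exists_minimalPrimes_comap_eq (I := ⊥) ι.toRingHom Q (by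
    rw [← RingHom.ker_eq_comap_bot, (RingHom.injective_iff_ker_eq_bot ι.toRingHom).1 hι]
    exact hQ)
  let ψ : A ⧸ Q →ₐ[k] B ⧸ P := Ideal.quotientMapₐ P ι hPQ.ge
  have hψ : Function.Injective ψ := Ideal.quotientMap_injective' (H := hPQ.ge) hPQ.le
  have hcB : AlgebraicIndependent k (fun i => Ideal.Quotient.mk P (ι (a i))) := by
    have := (AlgHom.algebraicIndependent_iff ψ hψ).2 hc
    convert this using 1
    ext i
    change _ = ψ (c i)
    rw [← hac]
    rfl
  obtain ⟨x, δ, h1, h2⟩ := exists_dual_point_derivations hsep hP hcB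
  exact ⟨a, x, δ, has, h1, h2⟩

end PointDerivations

/-! ### Point derivations at the identity and invariant derivations -/

section TangentSpace

variable {k H : Type*} [Field k] [Group H]

/-- The tangent space at `1` of a group with algebra of functions `B`: the point derivations. -/
def tangentSpace (B : Subalgebra k (H → k)) : Submodule k (Module.Dual k B) where
  carrier := {X | ∀ f g : B, X (f * g) = (f : H → k) 1 * X g + (g : H → k) 1 * X f}
  add_mem' {X Y} hX hY f g := by
    rw [LinearMap.add_apply, hX, hY, LinearMap.add_apply, LinearMap.add_apply]; ring
  zero_mem' f g := by simp
  smul_mem' r X hX f g := by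
    rw [LinearMap.smul_apply, hX, LinearMap.smul_apply, LinearMap.smul_apply]
    simp only [smul_eq_mul]; ring

/-- Multiplication pulls back `B` to finite sums of products of functions in `B`. -/
def HasComul (B : Subalgebra k (H → k)) : Prop :=
  ∀ f ∈ B, ∃ (n : ℕ) (a b : Fin n → B),
    ∀ x y : H, f (x * y) = ∑ i, (a i : H → k) x * (b i : H → k) y

variable {B : Subalgebra k (H → k)}

theorem HasComul.translate_mem (hB : HasComul B) (x : H) {f : H → k} (hf : f ∈ B) :
    (fun y => f (x * y)) ∈ B := by
  obtain ⟨n, a, b, hab⟩ := hB f hf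
  have : (fun y => f (x * y)) = ∑ i, (a i : H → k) x • (b i : H → k) := by
    ext y
    rw [hab]
    simp
  rw [this]
  exact sum_mem fun i _ => B.smul_mem (b i).2 _

/-- Left translation as an endomorphism of the algebra of functions. -/
def HasComul.translate (hB : HasComul B) (x : H) : B →ₐ[k] B where
  toFun f := ⟨fun y => (f : H → k) (x * y), hB.translate_mem x f.2⟩
  map_one' := rfl
  map_mul' _ _ := rfl
  map_zero' := rfl
  map_add' _ _ := rfl
  commutes' _ := rfl

theorem HasComul.translate_apply (hB : HasComul B) (x y : H) (f : B) :
    (hB.translate x f : H → k) y = (f : H → k) (x * y) := rfl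

theorem HasComul.invariant_mem (hB : HasComul B) (X : Module.Dual k B) (f : B) :
    (fun x => X (hB.translate x f)) ∈ B := by
  obtain ⟨n, a, b, hab⟩ := hB f f.2
  have h1 : ∀ x, hB.translate x f = ∑ i, (a i : H → k) x • b i := by
    intro x
    ext y
    rw [hB.translate_apply, hab]
    simp
  have h2 : (fun x => X (hB.translate x f)) = ∑ i, X (b i) • (a i : H → k) := by
    ext x
    rw [h1]
    simp [mul_comm]
  rw [h2]
  exact sum_mem fun i _ => B.smul_mem (a i).2 _

/-- The left invariant derivation with a given value at `1`. -/
def HasComul.invariantDerivation (hB : HasComul B) (X : Module.Dual k B)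
    (hX : X ∈ tangentSpace B) : Derivation k B B :=
  Derivation.mk'
    { toFun := fun f => ⟨fun x => X (hB.translate x f), hB.invariant_mem X f⟩
      map_add' := fun f g => by ext x; simp
      map_smul' := fun r f => by ext x; simp }
    (fun f g => by
      ext x
      change X (hB.translate x (f * g)) =
        (f : H → k) x * X (hB.translate x g) + (g : H → k) x * X (hB.translate x f)
      rw [map_mul, hX, hB.translate_apply, hB.translate_apply, mul_one])

theorem HasComul.translate_one (hB : HasComul B) (f : B) : hB.translate 1 f = f := by
  ext y
  rw [hB.translate_apply, one_mul]

end TangentSpace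

/-! ### Orbit dimension as the rank of the derivative of the orbit map -/

section OrbitTangent

variable {k H V : Type*} [Field k] [Group H] [AddCommGroup V] [Module k V]
  [DistribMulAction H V]

/-- All matrix coefficients of the action are in `B`. -/
def HasCoefficientsIn (B : Subalgebra k (H → k)) (V : Type*) [AddCommGroup V] [Module k V]
    [DistribMulAction H V] : Prop :=
  ∀ (φ : Module.Dual k V) (v : V), (fun g : H => φ (g • v)) ∈ B

variable {B : Subalgebra k (H → k)}

/-- The matrix coefficients at a vector `v`. -/
def HasCoefficientsIn.coeff (hV : HasCoefficientsIn B V) (v : V) : Module.Dual k V →ₗ[k] B where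
  toFun φ := ⟨fun g => φ (g • v), hV φ v⟩
  map_add' _ _ := rfl
  map_smul' _ _ := rfl

variable [FiniteDimensional k V]

/-- The derivative at `1` of the orbit map of `v`. -/
noncomputable def HasCoefficientsIn.orbitMap (hV : HasCoefficientsIn B V) (v : V) :
    Module.Dual k B →ₗ[k] V :=
  (Module.evalEquiv k V).symm.toLinearMap ∘ₗ (hV.coeff v).dualMap

theorem HasCoefficientsIn.dual_orbitMap (hV : HasCoefficientsIn B V) (v : V)
    (X : Module.Dual k B) (φ : Module.Dual k V) : φ (hV.orbitMap v X) = X (hV.coeff v φ) := by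
  change φ ((Module.evalEquiv k V).symm ((hV.coeff v).dualMap X)) = _
  rw [Module.apply_evalEquiv_symm_apply]
  rfl

/-- The tangent space at `v` of the orbit of `v`. -/
noncomputable def HasCoefficientsIn.orbitTangent (hV : HasCoefficientsIn B V) (v : V) :
    Submodule k V :=
  (tangentSpace B).map (hV.orbitMap v)

theorem regularFunctions_fg : (regularFunctions k V).FG := by
  rw [← range_polynomialFunction, ← Algebra.map_top]
  exact (Algebra.FiniteType.out).map _

omit [FiniteDimensional k V] in
theorem adjoin_restrictions_eq_top (X : Set V) :
    Algebra.adjoin k (Set.range fun φ : Module.Dual k V =>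
      (⟨fun x : X => φ x, φ, dual_mem_regularFunctions φ, rfl⟩ :
        restrictedRegularFunctions k X)) = ⊤ := by
  apply Subalgebra.map_injective (f := (restrictedRegularFunctions k X).val)
    Subtype.val_injective
  rw [AlgHom.map_adjoin, Algebra.map_top, Subalgebra.range_val, ← Set.range_comp]
  refine Eq.trans ?_ (AlgHom.map_adjoin _ _).symm
  rw [← Set.range_comp]
  rfl

theorem restrictedRegularFunctions_fg (X : Set V) : (restrictedRegularFunctions k X).FG :=
  regularFunctions_fg.map _

omit [FiniteDimensional k V] in
theorem HasCoefficientsIn.pullback_mem (hV : HasCoefficientsIn B V) (v : V) {f : V → k}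
    (hf : f ∈ regularFunctions k V) : (fun g : H => f (g • v)) ∈ B := by
  induction hf using Algebra.adjoin_induction with
  | mem x hx =>
    obtain ⟨φ, rfl⟩ := hx
    exact hV φ v
  | algebraMap r => exact B.algebraMap_mem r
  | add x y _ _ hx hy => exact add_mem hx hy
  | mul x y _ _ hx hy => exact mul_mem hx hy

/-- The pullback of functions on the orbit of `v` along the orbit map. -/
def HasCoefficientsIn.pullback (hV : HasCoefficientsIn B V) (v : V) :
    restrictedRegularFunctions k (MulAction.orbit H v) →ₐ[k] B where
  toFun f := ⟨fun g => f.1 ⟨g • v, g, rfl⟩, by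
    obtain ⟨_, F, hF, rfl⟩ := f
    exact hV.pullback_mem v hF⟩
  map_one' := rfl
  map_mul' _ _ := rfl
  map_zero' := rfl
  map_add' _ _ := rfl
  commutes' _ := rfl

omit [FiniteDimensional k V] in
theorem HasCoefficientsIn.pullback_injective (hV : HasCoefficientsIn B V) (v : V) :
    Function.Injective (hV.pullback v) := by
  intro f f' h
  ext ⟨_, g, rfl⟩
  exact congrFun (congrArg Subtype.val h) g

variable [CharZero k]

omit [CharZero k] in
theorem HasCoefficientsIn.exists_dual_families (hV : HasCoefficientsIn B V) (v : V) {n : ℕ}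
    (hn : n ≤ Module.finrank k (hV.orbitTangent v)) :
    ∃ (X : Fin n → Module.Dual k B) (φ : Fin n → Module.Dual k V), (∀ j, X j ∈ tangentSpace B) ∧
      ∀ i j, φ i (hV.orbitMap v (X j)) = if i = j then 1 else 0 := by
  let b := Module.finBasis k (hV.orbitTangent v)
  let ι := Fin.castLEEmb hn
  have hX : ∀ j, ∃ X ∈ tangentSpace B, hV.orbitMap v X = b j := fun j => (b j).2
  choose X hX hXb using hX
  have hφ : ∀ i, ∃ φ : Module.Dual k V, ∀ j, φ (b j) = if i = j then 1 else 0 := by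
    intro i
    obtain ⟨φ, hφ⟩ := LinearMap.exists_extend (b.coord i)
    refine ⟨φ, fun j => ?_⟩
    have := LinearMap.congr_fun hφ (b j)
    change φ (b j) = _ at this
    rw [this, Module.Basis.coord_apply, Module.Basis.repr_self, Finsupp.single_apply]
    simp only [eq_comm]
  choose φ hφ using hφ
  refine ⟨fun i => X (ι i), fun i => φ (ι i), fun i => hX _, fun i j => ?_⟩
  rw [hXb, hφ]
  simp only [ι.injective.eq_iff]

omit [CharZero k] in
theorem HasCoefficientsIn.le_finrank_of_det_ne_zero (hV : HasCoefficientsIn B V) (v : V) {n : ℕ}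
    {X : Fin n → Module.Dual k B} (hX : ∀ j, X j ∈ tangentSpace B)
    (φ : Fin n → Module.Dual k V)
    (hdet : (Matrix.of fun i j => φ i (hV.orbitMap v (X j))).det ≠ 0) :
    n ≤ Module.finrank k (hV.orbitTangent v) := by
  let w : Fin n → hV.orbitTangent v := fun j => ⟨hV.orbitMap v (X j), X j, hX j, rfl⟩
  have hw : LinearIndependent k w := by
    rw [Fintype.linearIndependent_iff]
    intro a ha
    have hmul : (Matrix.of fun i j => φ i (hV.orbitMap v (X j))).mulVec a = 0 := by
      ext i
      have := congrArg (fun u : hV.orbitTangent v => φ i u) ha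
      simpa [w, Matrix.mulVec, dotProduct, mul_comm] using this
    exact congrFun (Matrix.eq_zero_of_mulVec_eq_zero hdet hmul)
  simpa using hw.fintype_card_le_finrank

/-- Extend tangent vectors to invariant derivations. Linear functionals dual to a basis of the orbit
tangent space then have Jacobian matrix `1` at the identity. -/
theorem HasCoefficientsIn.finrank_orbitTangent_le (hV : HasCoefficientsIn B V) (hfg : B.FG)
    (hB : HasComul B) (v : V) :
    (Module.finrank k (hV.orbitTangent v) : WithBot ℕ∞) ≤ zariskiDim k (MulAction.orbit H v) := by
  classical
  obtain ⟨X, φ, hX, hφ⟩ := hV.exists_dual_families v le_rfl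
  have : Algebra.FiniteType k B := (Subalgebra.fg_iff_finiteType B).1 hfg
  have : Algebra.FiniteType k (restrictedRegularFunctions k (MulAction.orbit H v)) :=
    (Subalgebra.fg_iff_finiteType _).1 (restrictedRegularFunctions_fg _)
  have : IsReduced B := isReduced_of_injective B.val Subtype.val_injective
  refine le_ringKrullDim_of_det_ne_zero (hV.pullback v)
    ((Pi.evalAlgHom k (fun _ : H => k) 1).comp B.val)
    (fun j => hB.invariantDerivation (X j) (hX j))
    (fun i => ⟨fun x => φ i x, φ i, dual_mem_regularFunctions _, rfl⟩) ?_
  have h1 : (Matrix.of fun j i => ((Pi.evalAlgHom k (fun _ : H => k) 1).comp B.val)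
      (hB.invariantDerivation (X j) (hX j) (hV.pullback v
        ⟨fun x => φ i x, φ i, dual_mem_regularFunctions _, rfl⟩))) = 1 := by
    ext j i
    change X j (hB.translate 1 (hV.coeff v (φ i))) = _
    rw [hB.translate_one, ← hV.dual_orbitMap, hφ, Matrix.one_apply]
    simp only [eq_comm]
  rw [h1, Matrix.det_one]
  exact one_ne_zero

theorem HasCoefficientsIn.le_finrank_orbitTangent [SMulCommClass H k V]
    (hV : HasCoefficientsIn B V) (hfg : B.FG)
    (hB : HasComul B) (v : V) {n : ℕ} (hn : n ≤ zariskiDim k (MulAction.orbit H v)) :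
    n ≤ Module.finrank k (hV.orbitTangent v) := by
  classical
  have : Algebra.FiniteType k B := (Subalgebra.fg_iff_finiteType B).1 hfg
  have : Algebra.FiniteType k (restrictedRegularFunctions k (MulAction.orbit H v)) :=
    (Subalgebra.fg_iff_finiteType _).1 (restrictedRegularFunctions_fg _)
  have : IsReduced B := isReduced_of_injective B.val Subtype.val_injective
  obtain ⟨a, h, δ, has, hδ, hδc⟩ := exists_dual_point_derivations_of_le_ringKrullDim
    (ev := fun x : H => (Pi.evalAlgHom k (fun _ : H => k) x).comp B.val)
    (fun f hf => Subtype.ext (funext hf)) (hV.pullback_injective v)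
    (adjoin_restrictions_eq_top (k := k) (MulAction.orbit H v)) hn
  choose φ hφ using has
  -- The dual point derivations live at some `h`; left translation moves them to the identity, and
  -- the functionals are composed with `h` to compensate.
  let X : Fin n → Module.Dual k B := fun i => δ i ∘ₗ (hB.translate h⁻¹).toLinearMap
  have hX : ∀ i, X i ∈ tangentSpace B := by
    intro i f g
    change δ i (hB.translate h⁻¹ (f * g)) = _ * δ i (hB.translate h⁻¹ g) +
      _ * δ i (hB.translate h⁻¹ f)
    rw [map_mul, hδ]
    change (f : H → k) (h⁻¹ * h) * _ + (g : H → k) (h⁻¹ * h) * _ = _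
    rw [inv_mul_cancel]
  let ψ' : Fin n → Module.Dual k V := fun j => φ j ∘ₗ DistribSMul.toLinearMap k V h
  have hψX : ∀ i j, ψ' j (hV.orbitMap v (X i)) = if i = j then 1 else 0 := by
    intro i j
    rw [hV.dual_orbitMap, ← hδc, ← hφ j]
    change δ i _ = _
    congr 1
    ext y
    change φ j (h • (h⁻¹ * y) • v) = φ j (y • v)
    rw [smul_smul, mul_inv_cancel_left]
  refine hV.le_finrank_of_det_ne_zero v hX ψ' ?_
  have h1 : (Matrix.of fun i j => ψ' i (hV.orbitMap v (X j))) = 1 := by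
    ext i j
    rw [Matrix.of_apply, hψX, Matrix.one_apply]
    simp only [eq_comm]
  rw [h1, Matrix.det_one]
  exact one_ne_zero

theorem HasCoefficientsIn.zariskiDim_orbit [SMulCommClass H k V]
    (hV : HasCoefficientsIn B V) (hfg : B.FG) (hB : HasComul B) (v : V) :
    zariskiDim k (MulAction.orbit H v) = (Module.finrank k (hV.orbitTangent v) : WithBot ℕ∞) := by
  refine le_antisymm ?_ (hV.finrank_orbitTangent_le hfg hB v)
  by_contra! hlt
  have h1 : ((Module.finrank k (hV.orbitTangent v) + 1 : ℕ) : WithBot ℕ∞) ≤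
      zariskiDim k (MulAction.orbit H v) := by
    rcases hd : zariskiDim k (MulAction.orbit H v) with _ | _ | m
    · rw [hd] at hlt; exact absurd hlt not_lt_bot
    · exact le_top
    · rw [hd] at hlt
      have hlt : ((_ : ℕ) : WithBot ℕ∞) < ((m : ℕ) : WithBot ℕ∞) := hlt
      have hlt' : Module.finrank k (hV.orbitTangent v) < m := by exact_mod_cast hlt
      change _ ≤ ((m : ℕ) : WithBot ℕ∞)
      exact_mod_cast hlt'
  have := hV.le_finrank_orbitTangent hfg hB v h1
  omega

end OrbitTangent

/-! ### Tangent spaces of subgroups -/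

section Subgroups

variable {k G V : Type*} [Field k] [Group G] [AddCommGroup V] [Module k V]
  [DistribMulAction G V] {B : Subalgebra k (G → k)} (S : Subgroup G)

/-- Restriction of functions from `G` to a subgroup. -/
def restrictFunctions (k : Type*) [Field k] : (G → k) →ₐ[k] (S → k) :=
  AlgHom.pi (fun s : S => Pi.evalAlgHom k (fun _ : G => k) (s : G))

variable (B) in
/-- Restriction of the functions in `B` to a subgroup. -/
def restrictSubalgebra : B →ₐ[k] B.map (restrictFunctions S k) where
  toFun f := ⟨fun s => (f : G → k) s, f, f.2, rfl⟩
  map_one' := rfl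
  map_mul' _ _ := rfl
  map_zero' := rfl
  map_add' _ _ := rfl
  commutes' _ := rfl

theorem restrictSubalgebra_surjective : Function.Surjective (restrictSubalgebra B S) := by
  rintro ⟨_, f, hf, rfl⟩
  exact ⟨⟨f, hf⟩, rfl⟩

theorem HasComul.restrict (hB : HasComul B) : HasComul (B.map (restrictFunctions S k)) := by
  rintro _ ⟨f, hf, rfl⟩
  obtain ⟨n, a, b, hab⟩ := hB f hf
  exact ⟨n, fun i => restrictSubalgebra B S (a i), fun i => restrictSubalgebra B S (b i),
    fun x y => hab x y⟩

theorem HasCoefficientsIn.restrict (hV : HasCoefficientsIn B V) :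
    HasCoefficientsIn (H := S) (B.map (restrictFunctions S k)) V :=
  fun φ v => ⟨_, hV φ v, rfl⟩

/-- The tangent vectors of `G` at `1` that annihilate all functions vanishing on `S`. -/
def tangentSpaceOf (B : Subalgebra k (G → k)) (S : Subgroup G) : Submodule k (Module.Dual k B) where
  carrier := {X | X ∈ tangentSpace B ∧ ∀ f : B, (∀ s ∈ S, (f : G → k) s = 0) → X f = 0}
  add_mem' hX hY := ⟨add_mem hX.1 hY.1, fun f hf => by
    rw [LinearMap.add_apply, hX.2 f hf, hY.2 f hf, add_zero]⟩
  zero_mem' := ⟨zero_mem _, fun _ _ => rfl⟩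
  smul_mem' r _ hX := ⟨Submodule.smul_mem _ r hX.1, fun f hf => by
    rw [LinearMap.smul_apply, hX.2 f hf, smul_zero]⟩

/-- Restriction of functions to `S` is surjective, so point derivations on `S` are exactly those on
`G` that kill the functions vanishing on `S`. -/
theorem HasCoefficientsIn.orbitTangent_restrict [FiniteDimensional k V]
    (hV : HasCoefficientsIn B V) (v : V) :
    (hV.restrict S).orbitTangent v = (tangentSpaceOf B S).map (hV.orbitMap v) := by
  have hmap : ∀ X : Module.Dual k (B.map (restrictFunctions S k)),
      (hV.restrict S).orbitMap v X =
        hV.orbitMap v (X ∘ₗ (restrictSubalgebra B S).toLinearMap) := by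
    intro X
    rw [← sub_eq_zero, ← Module.forall_dual_apply_eq_zero_iff k]
    intro φ
    rw [map_sub, sub_eq_zero, HasCoefficientsIn.dual_orbitMap, HasCoefficientsIn.dual_orbitMap]
    rfl
  apply le_antisymm
  · rintro _ ⟨X, hX, rfl⟩
    refine ⟨X ∘ₗ (restrictSubalgebra B S).toLinearMap, ⟨fun f g => ?_, fun f hf => ?_⟩,
      (hmap X).symm⟩
    · change X (restrictSubalgebra B S (f * g)) = _
      rw [map_mul, hX]
      rfl
    · have : restrictSubalgebra B S f = 0 := by
        ext s
        exact hf s s.2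
      change X (restrictSubalgebra B S f) = 0
      rw [this, map_zero]
  · rintro _ ⟨X, ⟨hX, hXS⟩, rfl⟩
    obtain ⟨g, hg⟩ := (restrictSubalgebra B S).toLinearMap.exists_rightInverse_of_surjective
      (LinearMap.range_eq_top.2 (restrictSubalgebra_surjective S))
    have hg' : ∀ f, restrictSubalgebra B S (g f) = f := fun f => LinearMap.congr_fun hg f
    have hXg : ∀ f f' : B, restrictSubalgebra B S f = restrictSubalgebra B S f' → X f = X f' := by
      intro f f' h
      rw [← sub_eq_zero, ← map_sub]
      apply hXS
      intro s hs
      exact sub_eq_zero.2 (congrFun (congrArg Subtype.val h) ⟨s, hs⟩)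
    refine ⟨X ∘ₗ g, fun f f' => ?_, ?_⟩
    · have h1 : X (g (f * f')) = X (g f * g f') := by
        apply hXg
        rw [hg', map_mul, hg', hg']
      have h2 : ∀ f : B.map (restrictFunctions S k), (f : S → k) 1 = (g f : G → k) 1 := fun f =>
        (congrFun (congrArg Subtype.val (hg' f)) 1).symm
      change X (g (f * f')) = _ * X (g f') + _ * X (g f)
      rw [h1, hX, h2, h2]
    · rw [hmap]
      congr 1
      ext f
      exact hXg _ _ (hg' _)

end Subgroups

/-! ### The tangent space of a stabilizer -/

section Stabilizers

theorem Ideal.mem_radical_of_forall_algHom_eq_zero {k A : Type*} [Field k] [IsAlgClosed k]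
    [CommRing A] [Algebra k A] [Algebra.FiniteType k A] {J : Ideal A} {f : A}
    (hf : ∀ χ : A →ₐ[k] k, (∀ p ∈ J, χ p = 0) → χ f = 0) : f ∈ J.radical := by
  have : IsJacobsonRing A := isJacobsonRing_of_finiteType (A := k)
  rw [Ideal.radical_eq_jacobson, Ideal.jacobson, Ideal.mem_sInf]
  rintro M ⟨hJM, hM⟩
  let _ : Field (A ⧸ M) := Ideal.Quotient.field M
  have : Module.Finite k (A ⧸ M) := finite_of_finite_type_of_isJacobsonRing k (A ⧸ M)
  let e := AlgEquiv.ofBijective (Algebra.ofId k (A ⧸ M))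
    IsAlgClosed.algebraMap_bijective_of_isIntegral
  have h := hf (e.symm.toAlgHom.comp (Ideal.Quotient.mkₐ k M)) (fun p hp => by
    change e.symm (Ideal.Quotient.mk M p) = 0
    rw [Ideal.Quotient.eq_zero_iff_mem.2 (hJM hp), map_zero])
  change e.symm (Ideal.Quotient.mk M f) = 0 at h
  rwa [EmbeddingLike.map_eq_zero_iff, Ideal.Quotient.eq_zero_iff_mem] at h

variable {k G V : Type*} [Field k] [IsAlgClosed k] [CharZero k] [Group G]
  [AffineAlgebraicGroup k G] [AddCommGroup V] [Module k V] [DistribMulAction G V]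

open AffineAlgebraicGroup

omit [IsAlgClosed k] [CharZero k] in
theorem AffineAlgebraicGroup.hasComul : HasComul (coordRing (k := k) (G := G)) := mul_regular

omit [CharZero k] in
/-- The Nullstellensatz for the coordinate ring of an affine algebraic group. -/
theorem AffineAlgebraicGroup.mem_radical (J : Ideal (coordRing (k := k) (G := G)))
    (f : coordRing (k := k) (G := G))
    (hf : ∀ g : G, (∀ p ∈ J, (p : G → k) g = 0) → (f : G → k) g = 0) : f ∈ J.radical := by
  have : Algebra.FiniteType k (coordRing (k := k) (G := G)) :=
    (Subalgebra.fg_iff_finiteType _).1 fg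
  refine Ideal.mem_radical_of_forall_algHom_eq_zero (k := k) fun χ hχ => ?_
  obtain ⟨g, rfl⟩ := eval_bijective.2 χ
  exact hf g hχ

/-- The functions `q φ` cut out the stabilizer. If `X` dies under the orbit map, its invariant
derivation kills every `q φ`, so it preserves the ideal they generate and, in characteristic 0, its
radical. By the Nullstellensatz the radical contains every `f` vanishing on the stabilizer;
evaluating the derivative of `f` at `1` gives `X f = 0`. -/
theorem HasCoefficientsIn.orbitMap_eq_zero_iff [FiniteDimensional k V] [SMulCommClass G k V]
    (hV : HasCoefficientsIn (coordRing (k := k) (G := G)) V) (v : V)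
    {X : Module.Dual k (coordRing (k := k) (G := G))} (hX : X ∈ tangentSpace coordRing) :
    hV.orbitMap v X = 0 ↔ X ∈ tangentSpaceOf coordRing (MulAction.stabilizer G v) := by
  have hcomul := AffineAlgebraicGroup.hasComul (k := k) (G := G)
  let q : Module.Dual k V → coordRing (k := k) (G := G) := fun φ =>
    hV.coeff v φ - algebraMap k _ (φ v)
  have hX1 : ∀ r : k, X (algebraMap k _ r) = 0 := by
    intro r
    have h1 : X 1 = 0 := by
      have := hX 1 1
      simpa using this
    rw [Algebra.algebraMap_eq_smul_one, map_smul, h1, smul_zero]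
  constructor
  · intro h0
    refine ⟨hX, fun f hf => ?_⟩
    let D := hcomul.invariantDerivation X hX
    have hD0 : ∀ φ, D (q φ) = 0 := by
      intro φ
      ext g
      change X (hcomul.translate g (q φ)) = 0
      rw [map_sub, AlgHom.commutes, map_sub, hX1, sub_zero]
      have h1 : hcomul.translate g (hV.coeff v φ) =
          hV.coeff v (φ ∘ₗ DistribSMul.toLinearMap k V g) := by
        ext x
        change φ ((g * x) • v) = φ (g • x • v)
        rw [mul_smul]
      rw [h1, ← hV.dual_orbitMap, h0, map_zero]
    let J := Ideal.span (Set.range q)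
    have hJ : ∀ a ∈ J, D a ∈ J := by
      intro a ha
      induction ha using Submodule.span_induction with
      | mem x hx =>
        obtain ⟨φ, rfl⟩ := hx
        rw [hD0]
        exact zero_mem _
      | zero => rw [map_zero]; exact zero_mem _
      | add x y _ _ hx hy => rw [map_add]; exact add_mem hx hy
      | smul a x hx' hx =>
        rw [smul_eq_mul, D.leibniz]
        exact add_mem (J.mul_mem_left _ hx) (J.mul_mem_right _ hx')
    have hfJ : f ∈ J.radical := by
      apply AffineAlgebraicGroup.mem_radical
      intro g hg
      apply hf
      rw [MulAction.mem_stabilizer_iff, ← sub_eq_zero, ← Module.forall_dual_apply_eq_zero_iff k]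
      intro φ
      rw [map_sub]
      exact hg (q φ) (Ideal.subset_span ⟨φ, rfl⟩)
    obtain ⟨n, hn⟩ := D.mem_radical_of_mem_radical hJ hfJ
    have hvan : ∀ p ∈ J, (p : G → k) 1 = 0 := by
      intro p hp
      induction hp using Submodule.span_induction with
      | mem x hx =>
        obtain ⟨φ, rfl⟩ := hx
        change φ ((1 : G) • v) - φ v = 0
        rw [one_smul, sub_self]
      | zero => rfl
      | add x y _ _ hx hy =>
        change (x : G → k) 1 + (y : G → k) 1 = 0
        rw [hx, hy, add_zero]
      | smul a x _ hx =>
        change (a : G → k) 1 * (x : G → k) 1 = 0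
        rw [hx, mul_zero]
    have h1 : X (hcomul.translate 1 f) ^ n = 0 := hvan _ hn
    rw [hcomul.translate_one] at h1
    exact eq_zero_of_pow_eq_zero h1
  · rintro ⟨-, hXS⟩
    rw [← Module.forall_dual_apply_eq_zero_iff k]
    intro φ
    rw [hV.dual_orbitMap]
    have := hXS (q φ) (fun s hs => by
      change φ (s • v) - φ v = 0
      rw [MulAction.mem_stabilizer_iff.1 hs, sub_self])
    rwa [map_sub, hX1, sub_zero] at this

end Stabilizers

/-! ### Ranks and kernels -/

section LinearAlgebra

variable {k E V V' : Type*} [Field k] [AddCommGroup E] [Module k E]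
  [AddCommGroup V] [Module k V] [AddCommGroup V'] [Module k V']

/-- Rank-nullity for the projection of the image to `V`. With `L` and `M` the derivatives of two
orbit maps, this becomes the orbit dimension formula. -/
theorem Submodule.finrank_map_prod [FiniteDimensional k V] [FiniteDimensional k V']
    (p : Submodule k E) (L : E →ₗ[k] V) (M : E →ₗ[k] V') :
    Module.finrank k (p.map (L.prod M)) =
      Module.finrank k (p.map L) + Module.finrank k ((p ⊓ LinearMap.ker L).map M) := by
  set W := p.map (L.prod M)
  let f : W →ₗ[k] V := (LinearMap.fst k V V').domRestrict W
  have hrange : LinearMap.range f = p.map L := by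
    rw [LinearMap.range_domRestrict, ← Submodule.map_comp, LinearMap.fst_prod]
  have hker : (LinearMap.ker f).map W.subtype =
      ((p ⊓ LinearMap.ker L).map M).map (LinearMap.inr k V V') := by
    ext ⟨a, b⟩
    constructor
    · rintro ⟨⟨_, e, he, rfl⟩, h, heq⟩
      have h : L e = 0 := h
      obtain ⟨rfl, rfl⟩ := Prod.ext_iff.1 heq
      refine ⟨M e, ⟨e, ⟨he, h⟩, rfl⟩, ?_⟩
      exact Prod.ext h.symm rfl
    · rintro ⟨_, ⟨e, ⟨he, h⟩, rfl⟩, heq⟩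
      have h : L e = 0 := h
      refine ⟨⟨(L e, M e), e, he, rfl⟩, h, ?_⟩
      rw [← heq]
      exact Prod.ext h rfl
  rw [← LinearMap.finrank_range_add_finrank_ker f, hrange,
    ← Submodule.finrank_map_subtype_eq W (LinearMap.ker f), hker,
    ← (Submodule.equivMapOfInjective (LinearMap.inr k V V') LinearMap.inr_injective _).finrank_eq]

theorem Submodule.finrank_map_eq_of_inf_ker_eq (p : Submodule k E) {L : E →ₗ[k] V}
    {M : E →ₗ[k] V'} (h : p ⊓ LinearMap.ker L = p ⊓ LinearMap.ker M) :
    Module.finrank k (p.map L) = Module.finrank k (p.map M) := by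
  have hker : LinearMap.ker (L.domRestrict p) = LinearMap.ker (M.domRestrict p) := by
    ext ⟨x, hx⟩
    have : x ∈ p ⊓ LinearMap.ker L ↔ x ∈ p ⊓ LinearMap.ker M := by rw [h]
    simpa [hx] using this
  rw [← LinearMap.range_domRestrict, ← LinearMap.range_domRestrict,
    ← (L.domRestrict p).quotKerEquivRange.finrank_eq,
    ← (M.domRestrict p).quotKerEquivRange.finrank_eq,
    (Submodule.quotEquivOfEq _ _ hker).finrank_eq]

end LinearAlgebra

/-! ### Lower semicontinuity of orbit dimension -/

section Semicontinuity

variable {k G V : Type*} [Field k] [Group G] [AddCommGroup V] [Module k V]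
  [DistribMulAction G V] [SMulCommClass G k V] [FiniteDimensional k V] {B : Subalgebra k (G → k)}

theorem HasCoefficientsIn.isZariskiOpen_le_finrank (hV : HasCoefficientsIn B V) (n : ℕ) :
    IsZariskiOpen k {v : V | n ≤ Module.finrank k (hV.orbitTangent v)} := by
  rw [isZariskiOpen_iff_forall_exists]
  intro v hv
  obtain ⟨X, φ, hX, hφ⟩ := hV.exists_dual_families v hv
  -- With `X j` and `φ i` fixed, the matrix entries are linear in the vector, so the minor that is
  -- `1` at `v` is a polynomial function.
  let ℓ : Fin n → Fin n → Module.Dual k V := fun i j =>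
    { toFun := fun w => X j (hV.coeff w (φ i))
      map_add' := fun a b => by
        rw [← map_add]
        congr 1
        ext g
        change φ i (g • (a + b)) = φ i (g • a) + φ i (g • b)
        rw [smul_add, map_add]
      map_smul' := fun r a => by
        rw [RingHom.id_apply, ← map_smul]
        congr 1
        ext g
        change φ i (g • r • a) = r • φ i (g • a)
        rw [smul_comm, map_smul] }
  let M : Matrix (Fin n) (Fin n) (regularFunctions k V) :=
    Matrix.of fun i j => ⟨ℓ i j, dual_mem_regularFunctions _⟩
  have hM : ∀ w, (M.det : V → k) w = (Matrix.of fun i j => φ i (hV.orbitMap w (X j))).det := by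
    intro w
    change ((Pi.evalAlgHom k (fun _ : V => k) w).comp (regularFunctions k V).val) M.det = _
    rw [AlgHom.map_det]
    congr 1
    ext i j
    exact (hV.dual_orbitMap w (X j) (φ i)).symm
  refine ⟨M.det, M.det.2, ?_, fun w hw => ?_⟩
  · rw [hM]
    have h1 : (Matrix.of fun i j => φ i (hV.orbitMap v (X j))) = 1 := by
      ext i j
      rw [Matrix.of_apply, hφ, Matrix.one_apply]
    rw [h1, Matrix.det_one]
    exact one_ne_zero
  · rw [hM] at hw
    exact hV.le_finrank_of_det_ne_zero w hX φ hw

omit [SMulCommClass G k V] in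
theorem HasCoefficientsIn.exists_forall_finrank_le (hV : HasCoefficientsIn B V) :
    ∃ v : V, ∀ w : V, Module.finrank k (hV.orbitTangent w) ≤
      Module.finrank k (hV.orbitTangent v) := by
  have hbdd : BddAbove (Set.range fun v : V => Module.finrank k (hV.orbitTangent v)) :=
    ⟨Module.finrank k V, by rintro _ ⟨v, rfl⟩; exact Submodule.finrank_le _⟩
  obtain ⟨v, hv⟩ := Nat.sSup_mem (Set.range_nonempty _) hbdd
  exact ⟨v, fun w => (le_csSup hbdd ⟨w, rfl⟩).trans hv.ge⟩

end Semicontinuity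

/-! ### Orbit maps on a direct sum -/

section Products

variable {k G V₁ V₂ : Type*} [Field k] [Group G] {B : Subalgebra k (G → k)}
  [AddCommGroup V₁] [Module k V₁] [DistribMulAction G V₁]
  [AddCommGroup V₂] [Module k V₂] [DistribMulAction G V₂]

theorem HasCoefficientsIn.prod (h₁ : HasCoefficientsIn B V₁) (h₂ : HasCoefficientsIn B V₂) :
    HasCoefficientsIn B (V₁ × V₂) := by
  rintro φ ⟨x, y⟩
  have : (fun g : G => φ (g • (x, y))) = (fun g => (φ ∘ₗ LinearMap.inl k V₁ V₂) (g • x)) +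
      (fun g => (φ ∘ₗ LinearMap.inr k V₁ V₂) (g • y)) := by
    ext g
    simp [← map_add]
  rw [this]
  exact add_mem (h₁ _ x) (h₂ _ y)

variable [FiniteDimensional k V₁] [FiniteDimensional k V₂]

theorem HasCoefficientsIn.orbitMap_prod (h₁ : HasCoefficientsIn B V₁)
    (h₂ : HasCoefficientsIn B V₂) (x : V₁) (y : V₂) :
    (h₁.prod h₂).orbitMap (x, y) = (h₁.orbitMap x).prod (h₂.orbitMap y) := by
  ext1 X
  rw [← sub_eq_zero, ← Module.forall_dual_apply_eq_zero_iff k]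
  intro φ
  have hφ : ∀ z : V₁ × V₂, φ z =
      (φ ∘ₗ LinearMap.inl k V₁ V₂) z.1 + (φ ∘ₗ LinearMap.inr k V₁ V₂) z.2 := by
    intro z
    simp [← map_add]
  rw [map_sub, sub_eq_zero, HasCoefficientsIn.dual_orbitMap, hφ]
  change _ = (φ ∘ₗ LinearMap.inl k V₁ V₂) (h₁.orbitMap x X) +
    (φ ∘ₗ LinearMap.inr k V₁ V₂) (h₂.orbitMap y X)
  rw [HasCoefficientsIn.dual_orbitMap, HasCoefficientsIn.dual_orbitMap, ← map_add]
  congr 1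
  ext g
  exact hφ (g • (x, y))

theorem HasCoefficientsIn.finrank_orbitTangent_swap (h₁ : HasCoefficientsIn B V₁)
    (h₂ : HasCoefficientsIn B V₂) (x : V₁) (y : V₂) :
    Module.finrank k ((h₂.prod h₁).orbitTangent (y, x)) =
      Module.finrank k ((h₁.prod h₂).orbitTangent (x, y)) := by
  rw [orbitTangent, orbitTangent, orbitMap_prod h₂ h₁, orbitMap_prod h₁ h₂]
  exact Submodule.finrank_map_eq_of_inf_ker_eq _ (by
    rw [LinearMap.ker_prod, LinearMap.ker_prod, inf_comm (LinearMap.ker _)])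

end Products

/-! ### Regular pairs and the main theorem -/

section Main

open AffineAlgebraicGroup

variable {k : Type*} [Field k] [IsAlgClosed k] [CharZero k]
  {G : Type*} [Group G] [AffineAlgebraicGroup k G]

section Orbits

variable {V : Type*} [AddCommGroup V] [Module k V] [FiniteDimensional k V]
  [DistribMulAction G V] [SMulCommClass G k V]

theorem HasCoefficientsIn.tangentSpace_inf_ker
    (hV : HasCoefficientsIn (coordRing (k := k) (G := G)) V) (v : V) :
    tangentSpace coordRing ⊓ LinearMap.ker (hV.orbitMap v) =
      tangentSpaceOf coordRing (MulAction.stabilizer G v) := by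
  ext X
  constructor
  · rintro ⟨hX, h0⟩
    exact (hV.orbitMap_eq_zero_iff v hX).1 h0
  · intro h
    exact ⟨h.1, (hV.orbitMap_eq_zero_iff v h.1).2 h⟩

omit [IsAlgClosed k] in
theorem HasCoefficientsIn.mem_regularElements_iff
    (hV : HasCoefficientsIn (coordRing (k := k) (G := G)) V) (v : V) :
    v ∈ regularElements k G V ↔ ∀ w, Module.finrank k (hV.orbitTangent w) ≤
      Module.finrank k (hV.orbitTangent v) := by
  refine forall_congr' fun w => ?_
  rw [hV.zariskiDim_orbit fg hasComul, hV.zariskiDim_orbit fg hasComul]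
  exact Nat.cast_le

omit [IsAlgClosed k] in
theorem HasCoefficientsIn.finrank_orbitTangent_smul
    (hV : HasCoefficientsIn (coordRing (k := k) (G := G)) V) (g : G) (v : V) :
    Module.finrank k (hV.orbitTangent (g • v)) = Module.finrank k (hV.orbitTangent v) := by
  have h := hV.zariskiDim_orbit fg hasComul (g • v)
  rw [MulAction.orbit_smul, hV.zariskiDim_orbit fg hasComul] at h
  exact_mod_cast h.symm

omit [IsAlgClosed k] in
theorem HasCoefficientsIn.finrank_le_of_mem_regularElements
    (hV : HasCoefficientsIn (coordRing (k := k) (G := G)) V) {S : Subgroup G} {v : V}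
    (hv : v ∈ regularElements k S V) (w : V) :
    Module.finrank k ((tangentSpaceOf coordRing S).map (hV.orbitMap w)) ≤
      Module.finrank k ((tangentSpaceOf coordRing S).map (hV.orbitMap v)) := by
  have hfg : (coordRing.map (restrictFunctions S k)).FG := (fg (k := k) (G := G)).map _
  have h := hv w
  rw [(hV.restrict S).zariskiDim_orbit hfg (hasComul.restrict S),
    (hV.restrict S).zariskiDim_orbit hfg (hasComul.restrict S),
    hV.orbitTangent_restrict, hV.orbitTangent_restrict] at h
  exact_mod_cast h

end Orbits

omit [IsAlgClosed k] [CharZero k] [AffineAlgebraicGroup k G] in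
theorem IsGenericIsotropyGroup.exists_dense {V : Type*} [AddCommGroup V] [Module k V]
    [MulAction G V] {S : Subgroup G} (hS : IsGenericIsotropyGroup k V S) :
    ∃ Ω : Set V, IsZariskiDense k Ω ∧ ∀ v ∈ Ω, ∃ g : G, MulAction.stabilizer G (g • v) = S := by
  obtain ⟨Ω, -, hd, hconj, v₀, hv₀, rfl⟩ := hS
  refine ⟨Ω, hd, fun v hv => ?_⟩
  obtain ⟨g, hg⟩ := hconj v hv v₀ hv₀
  exact ⟨g, by rw [MulAction.stabilizer_smul_eq_stabilizer_map_conj, hg]⟩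

variable {V₁ V₂ : Type*}
  [AddCommGroup V₁] [Module k V₁] [FiniteDimensional k V₁]
  [DistribMulAction G V₁] [SMulCommClass G k V₁]
  [AddCommGroup V₂] [Module k V₂] [FiniteDimensional k V₂]
  [DistribMulAction G V₂] [SMulCommClass G k V₂]
  (h₁ : HasCoefficientsIn (coordRing (k := k) (G := G)) V₁)
  (h₂ : HasCoefficientsIn (coordRing (k := k) (G := G)) V₂)

omit [SMulCommClass G k V₂] in
theorem HasCoefficientsIn.finrank_orbitTangent_prod (x : V₁) (y : V₂) :
    Module.finrank k ((h₁.prod h₂).orbitTangent (x, y)) =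
      Module.finrank k (h₁.orbitTangent x) +
      Module.finrank k ((tangentSpaceOf coordRing (MulAction.stabilizer G x)).map
        (h₂.orbitMap y)) := by
  rw [orbitTangent, orbitMap_prod, Submodule.finrank_map_prod, h₁.tangentSpace_inf_ker]
  rfl

/-- By semicontinuity the first coordinate of `z` can be made generic without lowering the
dimension, and a translation then gives it stabilizer `S`. In the dimension formula the first term
depends only on the stabilizer, and the second is largest at an `S`-regular vector. -/
theorem HasCoefficientsIn.finrank_le_of_stabilizer_eq {S : Subgroup G}
    (hS : IsGenericIsotropyGroup k V₁ S) {u : V₁} (hu : MulAction.stabilizer G u = S) {y : V₂}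
    (hy : y ∈ regularElements k S V₂) (z : V₁ × V₂) :
    Module.finrank k ((h₁.prod h₂).orbitTangent z) ≤
      Module.finrank k ((h₁.prod h₂).orbitTangent (u, y)) := by
  obtain ⟨Ω, hd, hΩ⟩ := hS.exists_dense
  obtain ⟨a, b⟩ := z
  have hopen := isZariskiOpen_preimage_affine (LinearMap.inl k V₁ V₂) (0, b)
    ((h₁.prod h₂).isZariskiOpen_le_finrank (Module.finrank k ((h₁.prod h₂).orbitTangent (a, b))))
  obtain ⟨a', ha', hle⟩ := hd _ hopen ⟨a, by simp⟩
  have hle : Module.finrank k ((h₁.prod h₂).orbitTangent (a, b)) ≤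
      Module.finrank k ((h₁.prod h₂).orbitTangent (a', b)) := by simpa using hle
  obtain ⟨g, hg⟩ := hΩ a' ha'
  refine hle.trans ?_
  have hgs : (g • a', g • b) = g • (a', b) := rfl
  rw [← (h₁.prod h₂).finrank_orbitTangent_smul g, ← hgs, h₁.finrank_orbitTangent_prod h₂,
    h₁.finrank_orbitTangent_prod h₂, hg, hu]
  refine add_le_add (le_of_eq ?_) (h₂.finrank_le_of_mem_regularElements hy _)
  exact Submodule.finrank_map_eq_of_inf_ker_eq _ (by
    rw [h₁.tangentSpace_inf_ker, h₁.tangentSpace_inf_ker, hg, hu])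

theorem HasCoefficientsIn.exists_zero_finrank_maximal {S : Subgroup G}
    (hS : IsGenericIsotropyGroup k V₁ S) (hcodim : CodimensionCondition 2 k S V₂)
    {f : V₁ × V₂ → k} (hf : f ∈ regularFunctions k (V₁ × V₂)) {x : V₁} {y y' : V₂}
    (hne : f (x, y) ≠ f (x, y')) :
    ∃ z, f z = 0 ∧ ∀ z', Module.finrank k ((h₁.prod h₂).orbitTangent z') ≤
      Module.finrank k ((h₁.prod h₂).orbitTangent z) := by
  by_contra! hcon
  obtain ⟨Ω, hd, hΩ⟩ := hS.exists_dense
  have hreg : ∀ y : V₂, (fun x : V₁ => f (x, y)) ∈ regularFunctions k V₁ := fun y => by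
    simpa using comp_affine_mem_regularFunctions (LinearMap.inl k V₁ V₂) (0, y) hf
  have hopen : IsZariskiOpen k {x : V₁ | f (x, y) ≠ f (x, y')} :=
    isZariskiOpen_iff_forall_exists.2 fun v hv =>
      ⟨_, sub_mem (hreg y) (hreg y'), sub_ne_zero.2 hv, fun w hw => sub_ne_zero.1 hw⟩
  obtain ⟨x', hx', hne'⟩ := hd _ hopen ⟨x, hne⟩
  obtain ⟨g, hg⟩ := hΩ x' hx'
  -- The twist by `g⁻¹` accounts for moving `x'` to `g • x'`, whose stabilizer is `S` itself and not
  -- just a conjugate.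
  have hF : (fun w : V₂ => f (x', g⁻¹ • w)) ∈ regularFunctions k V₂ := by
    simpa using comp_affine_mem_regularFunctions
      (LinearMap.inr k V₁ V₂ ∘ₗ DistribSMul.toLinearMap k V₂ g⁻¹) (x', 0) hf
  refine not_codim_two_of_zero_subset hF ⟨g • y, g • y', ?_⟩
    (Y := (regularElements k S V₂)ᶜ) (fun w hw hwreg => ?_) hcodim
  · simpa using hne'
  · obtain ⟨z', hz'⟩ := hcon _ hw
    refine absurd (h₁.finrank_le_of_stabilizer_eq h₂ hS hg hwreg z') (not_le.2 ?_)
    have hgs : (g • x', w) = g • (x', g⁻¹ • w) := by simp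
    rwa [hgs, (h₁.prod h₂).finrank_orbitTangent_smul g]

end Main

theorem mainTheorem7
    {k : Type*} [Field k] [IsAlgClosed k] [CharZero k]
    {G : Type*} [Group G] [AffineAlgebraicGroup k G]
    {V₁ V₂ : Type*}
    [AddCommGroup V₁] [Module k V₁] [FiniteDimensional k V₁]
    [DistribMulAction G V₁] [SMulCommClass G k V₁]
    [AddCommGroup V₂] [Module k V₂] [FiniteDimensional k V₂]
    [DistribMulAction G V₂] [SMulCommClass G k V₂]
    (hV₁ : IsRationalAction k G V₁) (hV₂ : IsRationalAction k G V₂)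
    (S₁ S₂ : Subgroup G)
    (hS₁ : IsGenericIsotropyGroup k V₁ S₁) (hS₂ : IsGenericIsotropyGroup k V₂ S₂)
    (h₁₂ : CodimensionCondition 2 k S₁ V₂) (h₂₁ : CodimensionCondition 2 k S₂ V₁) :
    CodimensionCondition 2 k G (V₁ × V₂) := by
  have h₁ : HasCoefficientsIn (AffineAlgebraicGroup.coordRing (k := k) (G := G)) V₁ := hV₁
  have h₂ : HasCoefficientsIn (AffineAlgebraicGroup.coordRing (k := k) (G := G)) V₂ := hV₂
  obtain ⟨z, hz⟩ := (h₁.prod h₂).exists_forall_finrank_le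
  have hreg : regularElements k G (V₁ × V₂) = {v |
      Module.finrank k ((h₁.prod h₂).orbitTangent z) ≤
      Module.finrank k ((h₁.prod h₂).orbitTangent v)} := by
    ext v
    rw [(h₁.prod h₂).mem_regularElements_iff]
    exact ⟨fun h => h z, fun h w => (hz w).trans h⟩
  by_contra hcodim
  obtain ⟨f, hf, ⟨⟨x, y⟩, ⟨x', y'⟩, hne⟩, hfZ⟩ := exists_zero_subset_of_not_codim_two
    (by
      rw [compl_compl, hreg]
      exact (h₁.prod h₂).isZariskiOpen_le_finrank _)
    (by
      rw [compl_compl, hreg]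
      exact ⟨z, le_refl (Module.finrank k _)⟩) hcodim
  -- Going from `(x, y)` to `(x', y')` through `(x, y')`, the value of `f` changes in one of the two
  -- moves, each of which alters a single coordinate.
  by_cases hxy : f (x, y) = f (x, y')
  · rw [hxy] at hne
    have hf' : (fun w : V₂ × V₁ => f (w.2, w.1)) ∈ regularFunctions k (V₂ × V₁) :=
      comp_linear_mem_regularFunctions (LinearEquiv.prodComm k V₂ V₁).toLinearMap hf
    obtain ⟨⟨b, a⟩, h0, hmax⟩ := h₂.exists_zero_finrank_maximal h₁ hS₂ h₂₁ hf' hne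
    refine hfZ _ h0 (((h₁.prod h₂).mem_regularElements_iff _).2 fun w => ?_)
    rw [← h₁.finrank_orbitTangent_swap h₂, ← h₁.finrank_orbitTangent_swap h₂]
    exact hmax (w.2, w.1)
  · obtain ⟨w, h0, hmax⟩ := h₁.exists_zero_finrank_maximal h₂ hS₁ h₁₂ hf hxy
    exact hfZ w h0 (((h₁.prod h₂).mem_regularElements_iff _).2 hmax)
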